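/- **Theorem (Entanglement monotone).** All Hilbert spaces are finite-dimensional, and the partial transpose is taken in a fixed orthonormal basis $\{|i\rangle_B\}_i$: $T_B(Y_{AB})=\sum_{i,j}(I_A\otimes|i\rangle\langle j|_B)\,Y_{AB}\,(I_A\otimes|i\rangle\langle j|_B)$. For $\alpha\in[1,\infty)$, a Hermitian $X\neq0$ and a positive semidefinite $\sigma\neq 0$, let $$\mu_\alpha(X\Vert\sigma)=\left\Vert \sigma^{\frac{1-\alpha}{2\alpha}}X\sigma^{\frac{1-\alpha}{2\alpha}}\right\Vert_\alpha\ \text{ if }\operatorname{supp}(X)\subseteq\operatorname{supp}(\sigma),\qquad \mu_\alpha(X\Vert\sigma)=+\infty\ \text{ otherwise},$$ where $\Vert Y\Vert_\alpha=(\operatorname{Tr}[|Y|^\alpha])^{1/\alpha}$, $|Y|=\sqrt{Y^\dagger Y}$, and powers of $\sigma$ are taken on its support. For $\alpha=\infty$ the same definition is used with $\Vert\cdot\Vert_\infty$ the operator norm and the exponent $-1/2$. Let $\nu_\alpha(X\Vert\sigma)=\log_2\mu_\alpha(X\Vert\sigma)$. For a bipartite state $\rho_{AB}$ the $\alpha$-logarithmic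 negativity is $$E_N^\alpha(\rho_{AB})=\inf_{\sigma_{AB}\in\operatorname{PPT}(A:B)}\nu_\alpha(T_B(\rho_{AB})\Vert\sigma_{AB}),$$ where $\operatorname{PPT}(A:B)=\{\sigma_{AB}:\sigma_{AB}\geq0,\ T_B(\sigma_{AB})\geq0,\ \operatorname{Tr}[\sigma_{AB}]=1\}$. A C-PPT-P quantum instrument is a finite collection $\{\mathcal N^x_{AB\to A'B'}\}_x$ of linear maps such that every $\mathcal N^x$ and every $T_{B'}\circ\mathcal N^x\circ T_B$ is completely positive and $\sum_x\mathcal N^x$ is trace preserving. A C-PPT-P channel is such an instrument with a single element. 1. Let $\{\mathcal N^x_{AB\to A'B'}\}_x$ be a C-PPT-P quantum instrument and $\rho_{AB}$ a bipartite state. Then for every $\alpha\in[1,\infty]$, $$E_N^\alpha(\rho_{AB})\ \geq\ \sum_{x:\,p(x)>0}p(x)\,E_N^\alpha(\rho^x_{A'B'}),\qquad p(x)=\operatorname{Tr}[\mathcal N^x(\rho_{AB})],\quad \rho^x_{A'B'}=\frac{1}{p(x)}\mathcal N^x(\rho_{AB}).$$ 2. In particular, if $\mathcal N_{AB\to A'B'}$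 is a C-PPT-P channel, then $E_N^\alpha(\mathcal N(\rho_{AB}))\leq E_N^\alpha(\rho_{AB})$ for every state $\rho_{AB}$ and every $\alpha\in[1,\infty]$. 3. Every LOCC instrument is a C-PPT-P instrument, so that 1 applies to it. Here the LOCC instruments are those with finitely many rounds: the smallest class of finite instruments that contains $\{\mathcal M^x\otimes\mathrm{id}_B\}_x$ and $\{\mathrm{id}_A\otimes\mathcal M^x\}_x$ for every local instrument $\{\mathcal M^x\}_x$ (completely positive maps with trace-preserving sum) of either party, and is closed under adaptive composition, $\{\mathcal N^x\}_x,\ \{\mathcal M^{x,y}\}_y\mapsto\{\mathcal M^{x,y}\circ\mathcal N^x\}_{x,y}$, and under coarse-graining, $\{\mathcal N^x\}_x\mapsto\{\sum_{x:f(x)=z}\mathcal N^x\}_z$ for a function $f$ of the outcome. -/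

import Mathlib

open scoped ComplexOrder ENNReal

universe u

noncomputable section

/-! Operators on a finite-dimensional Hilbert space with a fixed orthonormal basis indexed by `n`
are matrices `Matrix n n ℂ`. A bipartite system `AB` has the index set `A × B`. -/

/-! ### States, partial transpose, PPT states -/

/-- Density operators: positive semidefinite and of unit trace. -/
def IsDensity {n : Type*} [Fintype n] (ρ : Matrix n n ℂ) : Prop :=
  ρ.PosSemidef ∧ ρ.trace = 1

/-- The partial transpose on the second system,
`T_B(Y) = ∑ i j, (I ⊗ |i⟩⟨j|) Y (I ⊗ |i⟩⟨j|)`, given by its matrix entries. -/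
def partialTransposeB (A B : Type*) : Matrix (A × B) (A × B) ℂ →ₗ[ℂ] Matrix (A × B) (A × B) ℂ where
  toFun Y := Matrix.of fun i j => Y (i.1, j.2) (j.1, i.2)
  map_add' _ _ := rfl
  map_smul' _ _ := rfl

/-- The set `PPT(A:B)` of states with positive partial transpose. -/
def pptStates (A B : Type*) [Fintype A] [Fintype B] : Set (Matrix (A × B) (A × B) ℂ) :=
  {σ | σ.PosSemidef ∧ (partialTransposeB A B σ).PosSemidef ∧ σ.trace = 1}

/-! ### The functions `μ_α`, `ν_α` and the `α`-logarithmic negativity -/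

/-- The support of an operator: the orthogonal complement of its kernel. -/
def opSupport {n : Type*} [Fintype n] [DecidableEq n] (M : Matrix n n ℂ) :
    Submodule ℂ (EuclideanSpace ℂ n) :=
  (LinearMap.ker (Matrix.toEuclideanLin M))ᗮ

/-- The generalized power `σ ^ s` of a positive semidefinite operator, taken on its support:
every eigenvalue `t ≠ 0` is sent to `t ^ s`, and the eigenvalue `0` is sent to `0`. -/
def suppPow {n : Type*} [Fintype n] [DecidableEq n] (σ : Matrix n n ℂ) (s : ℝ) : Matrix n n ℂ :=
  cfc (fun t : ℝ => if t = 0 then 0 else t ^ s) σ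

/-- `|Y| = √(Y† Y)`. -/
def opAbs {n : Type*} [Fintype n] [DecidableEq n] (Y : Matrix n n ℂ) : Matrix n n ℂ :=
  cfc Real.sqrt (Y.conjTranspose * Y)

/-- The `α`-norm `(Tr |Y| ^ α) ^ (1 / α)` for `1 ≤ α < ∞`, and the operator norm for `α = ∞`. -/
def alphaNorm {n : Type*} [Fintype n] [DecidableEq n] (α : ℝ≥0∞) (Y : Matrix n n ℂ) : ℝ :=
  if α = ∞ then ‖Matrix.toEuclideanCLM (n := n) (𝕜 := ℂ) Y‖
  else (cfc (fun t : ℝ => t ^ α.toReal) (opAbs Y)).trace.re ^ (1 / α.toReal)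

/-- The exponent `(1 - α) / (2 α) = (1 / α - 1) / 2`, which is `- 1 / 2` for `α = ∞`. -/
def sandwichExponent (α : ℝ≥0∞) : ℝ := (α⁻¹.toReal - 1) / 2

open Classical in
/-- `μ_α(X‖σ)`, the `α`-norm of `σ ^ ((1-α)/(2α)) X σ ^ ((1-α)/(2α))` if
`supp X ⊆ supp σ`, and `+∞` otherwise. -/
def muAlpha {n : Type*} [Fintype n] [DecidableEq n] (α : ℝ≥0∞) (X σ : Matrix n n ℂ) : ℝ≥0∞ :=
  if opSupport X ≤ opSupport σ then
    ENNReal.ofReal (alphaNorm α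
      (suppPow σ (sandwichExponent α) * X * suppPow σ (sandwichExponent α)))
  else ∞

/-- `ν_α(X‖σ) = log₂ μ_α(X‖σ)`, with values in the extended reals. -/
def nuAlpha {n : Type*} [Fintype n] [DecidableEq n] (α : ℝ≥0∞) (X σ : Matrix n n ℂ) : EReal :=
  ENNReal.log (muAlpha α X σ) / (Real.log 2 : ℝ)

/-- The `α`-logarithmic negativity
`E_N^α(ρ_AB) = inf {ν_α(T_B(ρ_AB)‖σ_AB) : σ_AB ∈ PPT(A:B)}`, for `1 ≤ α ≤ ∞`. -/
def alphaLogNeg {A B : Type*} [Fintype A] [Fintype B] [DecidableEq A] [DecidableEq B]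
    (α : ℝ≥0∞) (ρ : Matrix (A × B) (A × B) ℂ) : EReal :=
  ⨅ σ ∈ pptStates A B, nuAlpha α (partialTransposeB A B ρ) σ

/-! ### Completely positive maps, instruments -/

/-- Linear maps from operators on the system `m` to operators on the system `n`. -/
abbrev SuperOp (m n : Type*) := Matrix m m ℂ →ₗ[ℂ] Matrix n n ℂ

/-- The map `id_R ⊗ Φ` acting on operators of the composite system `R × m`. -/
def idTensor (R : Type*) {m n : Type*} (Φ : SuperOp m n) : SuperOp (R × m) (R × n) where
  toFun M := Matrix.of fun i j => Φ (Matrix.of fun k l => M (i.1, k) (j.1, l)) i.2 j.2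
  map_add' M N := by
    ext i j
    exact congrFun (congrFun (Φ.map_add (Matrix.of fun k l => M (i.1, k) (j.1, l))
      (Matrix.of fun k l => N (i.1, k) (j.1, l))) i.2) j.2
  map_smul' c M := by
    ext i j
    exact congrFun (congrFun (Φ.map_smul c (Matrix.of fun k l => M (i.1, k) (j.1, l))) i.2) j.2

/-- The map `Φ ⊗ id_R` acting on operators of the composite system `m × R`. -/
def tensorId (R : Type*) {m n : Type*} (Φ : SuperOp m n) : SuperOp (m × R) (n × R) where
  toFun M := Matrix.of fun i j => Φ (Matrix.of fun k l => M (k, i.2) (l, j.2)) i.1 j.1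
  map_add' M N := by
    ext i j
    exact congrFun (congrFun (Φ.map_add (Matrix.of fun k l => M (k, i.2) (l, j.2))
      (Matrix.of fun k l => N (k, i.2) (l, j.2))) i.1) j.1
  map_smul' c M := by
    ext i j
    exact congrFun (congrFun (Φ.map_smul c (Matrix.of fun k l => M (k, i.2) (l, j.2))) i.1) j.1

/-- Complete positivity: `id_k ⊗ Φ` preserves positive semidefiniteness for every `k`. -/
def IsCP {m n : Type*} (Φ : SuperOp m n) : Prop :=
  ∀ (k : ℕ) (M : Matrix (Fin k × m) (Fin k × m) ℂ),
    M.PosSemidef → (idTensor (Fin k) Φ M).PosSemidef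

/-- Trace preservation. -/
def IsTP {m n : Type*} [Fintype m] [Fintype n] (Φ : SuperOp m n) : Prop :=
  ∀ M : Matrix m m ℂ, (Φ M).trace = M.trace

/-- A quantum instrument: a finite collection of completely positive maps whose sum is trace
preserving. -/
def IsInstrument {X m n : Type*} [Fintype X] [Fintype m] [Fintype n]
    (N : X → SuperOp m n) : Prop :=
  (∀ x, IsCP (N x)) ∧ IsTP (∑ x, N x)

/-- A C-PPT-P channel: `N` is completely positive and trace preserving, and `T_{B'} ∘ N ∘ T_B` is
completely positive. -/
def IsCPPTPChannel {A B A' B' : Type*} [Fintype A] [Fintype B] [Fintype A'] [Fintype B']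
    (N : SuperOp (A × B) (A' × B')) : Prop :=
  IsCP N ∧ IsTP N ∧ IsCP (partialTransposeB A' B' ∘ₗ N ∘ₗ partialTransposeB A B)

/-- A C-PPT-P instrument: each `N x` and each `T_{B'} ∘ N x ∘ T_B` is completely positive, and the
sum of the `N x` is trace preserving. -/
def IsCPPTPInstrument {X A B A' B' : Type*} [Fintype X] [Fintype A] [Fintype B] [Fintype A']
    [Fintype B'] (N : X → SuperOp (A × B) (A' × B')) : Prop :=
  (∀ x, IsCP (N x)) ∧
  (∀ x, IsCP (partialTransposeB A' B' ∘ₗ N x ∘ₗ partialTransposeB A B)) ∧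
  IsTP (∑ x, N x)

/-- LOCC instruments (any finite number of rounds of classical communication). One party applies a
local instrument and broadcasts the outcome; conditioned on the record `x` of the outcomes so far,
the parties continue with an LOCC instrument that depends on `x`; finally, the classical record may
be processed, which means that the outcomes are coarse-grained along a function `f`. -/
inductive IsLOCC : ∀ {X A B A' B' : Type u}, (X → SuperOp (A × B) (A' × B')) → Prop
  | alice {X A A' B : Type u} [Fintype X] [Fintype A] [Fintype A'] [Fintype B]
      (N : X → SuperOp A A') (hN : IsInstrument N) :
      IsLOCC (fun x => (tensorId B (N x) : SuperOp (A × B) (A' × B)))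
  | bob {X A B B' : Type u} [Fintype X] [Fintype A] [Fintype B] [Fintype B']
      (N : X → SuperOp B B') (hN : IsInstrument N) :
      IsLOCC (fun x => (idTensor A (N x) : SuperOp (A × B) (A × B')))
  | comp {X Y A B A₁ B₁ A' B' : Type u} [Fintype X] [Fintype Y] [Fintype A] [Fintype B]
      [Fintype A₁] [Fintype B₁] [Fintype A'] [Fintype B']
      (N : X → SuperOp (A × B) (A₁ × B₁)) (M : X → Y → SuperOp (A₁ × B₁) (A' × B'))
      (hN : IsLOCC N) (hM : ∀ x, IsLOCC (M x)) :
      IsLOCC (fun p : X × Y => M p.1 p.2 ∘ₗ N p.1)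
  | coarseGrain {X Z A B A' B' : Type u} [Fintype X] [Fintype Z] [DecidableEq Z]
      [Fintype A] [Fintype B] [Fintype A'] [Fintype B']
      (N : X → SuperOp (A × B) (A' × B')) (hN : IsLOCC N) (f : X → Z) :
      IsLOCC (fun z => ∑ x with f x = z, N x)

/-- The probability `p(x) = Tr[N^x(ρ)]` of an outcome with map `Nx` on the state `ρ`. -/
def outcomeProb {m n : Type*} [Fintype n] (Nx : SuperOp m n) (ρ : Matrix m m ℂ) : ℝ :=
  (Nx ρ).trace.re

/-- The normalized post-measurement state `N^x(ρ) / p(x)`. -/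
def postState {m n : Type*} [Fintype n] (Nx : SuperOp m n) (ρ : Matrix m m ℂ) : Matrix n n ℂ :=
  ((outcomeProb Nx ρ)⁻¹ : ℂ) • Nx ρ

end

/-! Fix a PPT state `σ` with `supp Y ⊆ supp σ`, where `Y = T_B(ρ)`. The maps `Φ^x = T_{B'} ∘ N^x ∘
T_B` are completely positive and their sum preserves the trace. With `q(x) = Tr Φ^x(σ)`, the
operator `τ^x = Φ^x(σ) / q(x)` is a PPT state, because `T_{B'}(Φ^x(σ)) = N^x(T_B(σ)) ≥ 0`, and
`Φ^x(Y) = p(x) T_{B'}(ρ^x)`. So `τ^x` is a competitor in the infimum for `ρ^x`.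

With `θ = 1 - 1/α` and `μ_x = μ_α(T_{B'}(ρ^x)‖τ^x)`, the core estimate (`sum_rpow_mul_alphaNorm_le`)
is `∑ (p/q)^θ p μ_x ≤ μ_α(Y‖σ)`. Concavity of the logarithm turns it into `θ ∑ p log(p/q) + ∑ p log
μ_x ≤ log μ_α(Y‖σ)`. The relative entropy is nonnegative because `∑ q ≤ 1`, so it can be dropped
(`sum_mul_log_le`).

The core estimate is complex interpolation between `α = 1` and `α = ∞`. The sandwiched `Y` is put on
an analytic curve `d v^(1-z)`, each sandwiched output is paired with a norming functional on a curve
`e w^z`, and the sandwiching exponents become `±z/2`. The resulting scalar function is at most one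
on `Re z = 0` because the `Φ^x` do not increase the trace in total, and on `Re z = 1` because
`Φ^x(σ) = q(x) τ^x`. The three lines theorem gives the value at `θ` (`norm_sum_sandwiched_le_one`).

Off the real axis the operators on these curves are not Hermitian, so order inequalities do not
apply to them. `Dominated` replaces both order and Hölder inequalities: positivity of a 2×2 block
operator survives completely positive maps and congruences, and it bounds the trace of the corner.

LOCC instruments are covered because Alice's maps commute with `T_B`, conjugating Bob's maps by
`T_B` keeps them completely positive, and composition and coarse-graining preserve both conditions.
-/

section

open Matrix

/-! ### Dominated operators -/

/-- The operator `M` is dominated by the pair `P, Q`: the block operator with diagonal blocks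
`P, Q` and upper right block `M` is positive semidefinite. -/
def Dominated {m : Type*} (P M Q : Matrix m m ℂ) : Prop :=
  ∃ N : Matrix m m ℂ, (fromBlocks P M N Q).PosSemidef

namespace Dominated

variable {m n : Type*} {P M Q : Matrix m m ℂ}

theorem posSemidef (h : Dominated P M Q) : (fromBlocks P M Mᴴ Q).PosSemidef := by
  obtain ⟨N, hN⟩ := h
  have := hN.isHermitian
  rw [isHermitian_fromBlocks_iff] at this
  rwa [this.2.1]

theorem left (h : Dominated P M Q) : P.PosSemidef := by
  obtain ⟨N, hN⟩ := h
  exact hN.submatrix (Sum.inl : m → m ⊕ m)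

theorem right (h : Dominated P M Q) : Q.PosSemidef := by
  obtain ⟨N, hN⟩ := h
  exact hN.submatrix (Sum.inr : m → m ⊕ m)

/-- Congruence by the block diagonal operator with blocks `A` and `Bᴴ`. The two factors around `M`
are independent, which is what allows non-Hermitian sandwiching. -/
theorem conj [Fintype m] (h : Dominated P M Q) (A B : Matrix m m ℂ) :
    Dominated (A * P * Aᴴ) (A * M * B) (Bᴴ * Q * B) := by
  refine ⟨Bᴴ * Mᴴ * Aᴴ, ?_⟩
  have := h.posSemidef.mul_mul_conjTranspose_same (fromBlocks A 0 0 Bᴴ)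
  simpa [fromBlocks_multiply, fromBlocks_conjTranspose] using this

/-- Only 2-positivity is used: the block operator lives on `ℂ² ⊗ m`, and `id ⊗ Φ` acts on it
blockwise. -/
theorem map {Φ : SuperOp m n} (hΦ : IsCP Φ) (h : Dominated P M Q) :
    Dominated (Φ P) (Φ M) (Φ Q) := by
  let e : Fin 2 × m → m ⊕ m := fun i => if i.1 = 0 then Sum.inl i.2 else Sum.inr i.2
  let f : n ⊕ n → Fin 2 × n := Sum.elim (fun j => (0, j)) (fun j => (1, j))
  refine ⟨Φ Mᴴ, ?_⟩
  have h2 := (hΦ 2 _ (h.posSemidef.submatrix e)).submatrix f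
  convert h2 using 1
  ext i j
  rcases i with i | i <;> rcases j with j | j <;> rfl

theorem re_mul_trace_le [Fintype m] (h : Dominated P M Q) {u : ℂ} (hu : ‖u‖ = 1) :
    2 * (u * M.trace).re ≤ P.trace.re + Q.trace.re := by
  classical
  -- Compressing by the block row `(u, -1)` leaves `P - u M - (u M)ᴴ + Q ≥ 0`, since `|u| = 1`; its
  -- trace is the claim.
  have h1 := h.posSemidef.mul_mul_conjTranspose_same
    (fromBlocks (u • (1 : Matrix m m ℂ)) (-1) 0 (0 : Matrix m m ℂ))
  have h2 := (Complex.le_def.1 h1.trace_nonneg).1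
  have hu2 : u.re * u.re + u.im * u.im = 1 := by
    have := Complex.sq_norm u
    rw [hu, Complex.normSq_apply] at this
    linarith
  simp only [fromBlocks_multiply, fromBlocks_conjTranspose, Matrix.trace, Fintype.sum_sum_type] at h2
  simp [Finset.sum_add_distrib, ← Finset.mul_sum, smul_smul] at h2
  rw [hu2] at h2
  simp only [Matrix.trace, Complex.mul_re, Complex.re_sum, Complex.im_sum, Matrix.diag_apply]
  linarith

theorem norm_trace_le [Fintype m] (h : Dominated P M Q) :
    2 * ‖M.trace‖ ≤ P.trace.re + Q.trace.re := by
  by_cases h0 : M.trace = 0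
  · have hP := (Complex.le_def.1 h.left.trace_nonneg).1
    have hQ := (Complex.le_def.1 h.right.trace_nonneg).1
    simp only [h0, norm_zero, Complex.zero_re] at hP hQ ⊢
    linarith
  · have hn : ‖M.trace‖ ≠ 0 := norm_ne_zero_iff.2 h0
    -- The phase that rotates `Tr M` onto the positive real axis.
    have := h.re_mul_trace_le (u := star M.trace / ‖M.trace‖) (by simp [hn])
    have e : star M.trace / ‖M.trace‖ * M.trace = (‖M.trace‖ : ℂ) := by
      rw [div_mul_eq_mul_div, mul_comm, Complex.star_def, Complex.mul_conj, Complex.normSq_eq_norm_sq]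
      have : (‖M.trace‖ : ℂ) ≠ 0 := by exact_mod_cast hn
      push_cast
      field_simp
    rwa [e, Complex.ofReal_re] at this

/-- The vector `(0, v)` annihilates the quadratic form of the positive block operator, so it lies in
its kernel; the upper component of that equation is `M v = 0`. -/
theorem mulVec_eq_zero [Fintype m] [DecidableEq m] (h : Dominated P M Q) {v : m → ℂ}
    (hv : Q *ᵥ v = 0) : M *ᵥ v = 0 := by
  have h1 := h.posSemidef
  have h2 := (h1.dotProduct_mulVec_zero_iff (Sum.elim (0 : m → ℂ) v)).1 (by
    rw [fromBlocks_mulVec]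
    simp [hv, dotProduct, Fintype.sum_sum_type])
  rw [fromBlocks_mulVec] at h2
  funext i
  simpa using congrFun h2 (Sum.inl i)

end Dominated

/-! ### Unitarily diagonalized operators -/

/-- The operator with eigenvectors the columns of `U` and eigenvalues `c`. -/
def unitaryDiag {n : Type*} [Fintype n] [DecidableEq n] (U : unitaryGroup n ℂ) (c : n → ℂ) :
    Matrix n n ℂ :=
  (U : Matrix n n ℂ) * diagonal c * (U : Matrix n n ℂ)ᴴ

namespace unitaryDiag

variable {n : Type*} [Fintype n] [DecidableEq n] (U : unitaryGroup n ℂ)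

theorem coe_conjTranspose_mul_self : (U : Matrix n n ℂ)ᴴ * (U : Matrix n n ℂ) = 1 :=
  mem_unitaryGroup_iff'.1 U.2

theorem coe_mul_conjTranspose_self : (U : Matrix n n ℂ) * (U : Matrix n n ℂ)ᴴ = 1 :=
  mem_unitaryGroup_iff.1 U.2

theorem mul (c d : n → ℂ) :
    unitaryDiag U c * unitaryDiag U d = unitaryDiag U (fun i => c i * d i) := by
  unfold unitaryDiag
  calc _ = (U : Matrix n n ℂ) * diagonal c * ((U : Matrix n n ℂ)ᴴ * (U : Matrix n n ℂ)) *
        diagonal d * (U : Matrix n n ℂ)ᴴ := by simp only [Matrix.mul_assoc]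
    _ = _ := by
      rw [coe_conjTranspose_mul_self, Matrix.mul_one, Matrix.mul_assoc _ (diagonal c),
        diagonal_mul_diagonal]

theorem conjTranspose (c : n → ℂ) :
    (unitaryDiag U c)ᴴ = unitaryDiag U (fun i => star (c i)) := by
  simp only [unitaryDiag, conjTranspose_mul, conjTranspose_conjTranspose, diagonal_conjTranspose,
    Matrix.mul_assoc]
  rfl

theorem trace (c : n → ℂ) : (unitaryDiag U c).trace = ∑ i, c i := by
  rw [unitaryDiag, trace_mul_comm, ← Matrix.mul_assoc, coe_conjTranspose_mul_self, Matrix.one_mul,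
    trace_diagonal]

theorem one : unitaryDiag U (fun _ => 1) = 1 := by
  rw [unitaryDiag, diagonal_one, Matrix.mul_one, coe_mul_conjTranspose_self]

theorem sub (c d : n → ℂ) :
    unitaryDiag U c - unitaryDiag U d = unitaryDiag U (fun i => c i - d i) := by
  rw [unitaryDiag, unitaryDiag, ← Matrix.sub_mul, ← Matrix.mul_sub, diagonal_sub]
  rfl

theorem smul (a : ℂ) (c : n → ℂ) :
    a • unitaryDiag U c = unitaryDiag U (fun i => a * c i) := by
  rw [unitaryDiag, unitaryDiag, ← Matrix.smul_mul, ← Matrix.mul_smul, ← diagonal_smul]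
  rfl

/-- Compression by a contraction with eigenvectors `U` does not increase the trace of a positive
semidefinite operator. -/
theorem trace_conj_le {c : n → ℂ} (hc : ∀ i, ‖c i‖ ≤ 1) {P : Matrix n n ℂ} (hP : P.PosSemidef) :
    (unitaryDiag U c * P * (unitaryDiag U c)ᴴ).trace.re ≤ P.trace.re := by
  -- The complementary contraction `D`, with `CᴴC + DᴴD = 1`. The traces of the two compressions add
  -- up to `Tr P`, and the one by `D` is nonnegative.
  let d : n → ℂ := fun i => ((Real.sqrt (1 - ‖c i‖ ^ 2) : ℝ) : ℂ)
  have h1 := (Complex.le_def.1 (hP.mul_mul_conjTranspose_same (unitaryDiag U d)).trace_nonneg).1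
  have h2 : (unitaryDiag U c)ᴴ * unitaryDiag U c + (unitaryDiag U d)ᴴ * unitaryDiag U d = 1 := by
    rw [add_comm, ← eq_sub_iff_add_eq, conjTranspose, conjTranspose, mul, mul, ← one U, sub]
    congr 1
    funext i
    have h3 : 0 ≤ 1 - ‖c i‖ ^ 2 := by nlinarith [hc i, norm_nonneg (c i)]
    have h4 : star (c i) * c i = ((‖c i‖ ^ 2 : ℝ) : ℂ) := by
      rw [mul_comm, Complex.star_def, Complex.mul_conj, Complex.normSq_eq_norm_sq]
    rw [h4]
    simp only [d, Complex.star_def, Complex.conj_ofReal]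
    rw [← Complex.ofReal_mul, Real.mul_self_sqrt h3]
    push_cast
    rfl
  have h5 : (unitaryDiag U c * P * (unitaryDiag U c)ᴴ).trace +
      (unitaryDiag U d * P * (unitaryDiag U d)ᴴ).trace = P.trace := by
    rw [trace_mul_cycle, trace_mul_cycle (unitaryDiag U d), ← trace_add, ← Matrix.add_mul, h2,
      Matrix.one_mul]
  have h6 := congrArg Complex.re h5
  simp only [Complex.add_re, Complex.zero_re] at h6 h1
  linarith

/-- An operator with eigenvalues `c` is dominated by one with eigenvalues `a` if `|c| ≤ a`. -/
theorem dominated {a : n → ℝ} {c : n → ℂ} (h : ∀ i, ‖c i‖ ≤ a i) :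
    Dominated (unitaryDiag U (fun i => a i)) (unitaryDiag U c) (unitaryDiag U (fun i => a i)) := by
  have h1 : Dominated (diagonal (fun i => (a i : ℂ))) (diagonal c) (diagonal (fun i => (a i : ℂ))) := by
    -- Schur complement, eigenvalue by eigenvalue: the block `[[a, c], [c̄, a]]` is the rank-one
    -- square of the column `(√a, c̄/√a)` plus `a - |c|²/a` in the lower corner. If `a = 0` then `c
    -- = 0`, and division by zero gives the right value.
    let s : n → ℂ := fun i => ((Real.sqrt (a i) : ℝ) : ℂ)
    let r : n → ℂ := fun i => ((a i - ‖c i‖ ^ 2 / a i : ℝ) : ℂ)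
    have ha : ∀ i, 0 ≤ a i := fun i => (norm_nonneg _).trans (h i)
    have hr : ∀ i, 0 ≤ r i := fun i => by
      rw [Complex.zero_le_real, sub_nonneg]
      rcases (ha i).eq_or_lt with h0 | h0
      · rw [← h0]; simp
      · rw [div_le_iff₀ h0]; nlinarith [h i, norm_nonneg (c i)]
    refine ⟨diagonal (fun i => star (c i)), ?_⟩
    have p1 := posSemidef_self_mul_conjTranspose (fromBlocks (diagonal s) (0 : Matrix n n ℂ)
      (diagonal (fun i => star (c i) / s i)) (0 : Matrix n n ℂ))
    have p2 : (fromBlocks 0 0 0 (diagonal r) : Matrix (n ⊕ n) (n ⊕ n) ℂ).PosSemidef := by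
      have e : (fromBlocks 0 0 0 (diagonal r) : Matrix (n ⊕ n) (n ⊕ n) ℂ) =
          diagonal (Sum.elim (fun _ => 0) r) := by
        rw [← fromBlocks_diagonal, diagonal_zero]
      rw [e]
      exact PosSemidef.diagonal fun i => by rcases i with i | i <;> simp [hr]
    have p3 := p1.add p2
    simp only [fromBlocks_conjTranspose, fromBlocks_multiply, fromBlocks_add,
      diagonal_conjTranspose, diagonal_mul_diagonal, diagonal_add, Matrix.conjTranspose_zero,
      Matrix.mul_zero, add_zero] at p3
    have hs : ∀ i, s i * s i = a i := fun i => by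
      simp only [s]; rw [← Complex.ofReal_mul, Real.mul_self_sqrt (ha i)]
    have hst : ∀ i, star (s i) = s i := fun i => by simp [s]
    have hc0 : ∀ i, s i = 0 → c i = 0 := fun i hi => by
      have : a i = 0 := by
        have := hs i
        rw [hi, mul_zero] at this
        exact_mod_cast this.symm
      have h2 := h i
      rw [this] at h2
      exact norm_le_zero_iff.1 h2
    convert p3 using 2
    · congr 1; funext i; simp [hst, hs]
    · congr 1; funext i
      by_cases h0 : s i = 0
      · simp [h0, hc0 i h0]
      · simp only [Pi.star_apply, star_div₀, star_star, hst]; field_simp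
    · congr 1; funext i
      by_cases h0 : s i = 0
      · simp [h0, hc0 i h0]
      · simp only [Pi.star_apply, hst]; field_simp
    · congr 1; funext i
      have h4 : star (c i) * c i = ((‖c i‖ ^ 2 : ℝ) : ℂ) := by
        rw [mul_comm, Complex.star_def, Complex.mul_conj, Complex.normSq_eq_norm_sq]
      simp only [Pi.star_apply, star_div₀, star_star, hst, r]
      rw [div_mul_div_comm, h4, hs]
      push_cast; ring
  have h2 := h1.conj (U : Matrix n n ℂ) (U : Matrix n n ℂ)ᴴ
  rwa [conjTranspose_conjTranspose] at h2

end unitaryDiag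

/-! ### Complex powers on the support -/

/-- The complex power `v ^ z` of a nonnegative number, with `0 ^ z = 0` for every `z`. -/
noncomputable def suppCpow (v : ℝ) (z : ℂ) : ℂ := if v = 0 then 0 else Complex.exp (Real.log v * z)

namespace suppCpow

theorem add (v : ℝ) (z w : ℂ) : suppCpow v (z + w) = suppCpow v z * suppCpow v w := by
  by_cases h : v = 0
  · simp [suppCpow, h]
  · simp [suppCpow, h, mul_add, Complex.exp_add]

theorem star_apply (v : ℝ) (z : ℂ) : star (suppCpow v z) = suppCpow v (star z) := by
  by_cases h : v = 0
  · simp [suppCpow, h]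
  · simp [suppCpow, h, ← Complex.exp_conj]

theorem ofReal {v : ℝ} (hv : 0 ≤ v) (s : ℝ) :
    suppCpow v s = ((if v = 0 then 0 else v ^ s : ℝ) : ℂ) := by
  by_cases h : v = 0
  · simp [suppCpow, h]
  · simp only [suppCpow, h, if_false]
    rw [Real.rpow_def_of_pos (lt_of_le_of_ne hv (Ne.symm h)), Complex.ofReal_exp]
    push_cast
    rfl

theorem one {v : ℝ} (hv : 0 ≤ v) : suppCpow v 1 = v := by
  have := ofReal hv 1
  rw [Complex.ofReal_one] at this
  rw [this]
  by_cases h : v = 0 <;> simp [h]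

theorem norm_apply {v : ℝ} (hv : 0 ≤ v) (z : ℂ) :
    ‖suppCpow v z‖ = if v = 0 then 0 else v ^ z.re := by
  by_cases h : v = 0
  · simp [suppCpow, h]
  · simp only [suppCpow, h, if_false, Complex.norm_exp]
    rw [Real.rpow_def_of_pos (lt_of_le_of_ne hv (Ne.symm h))]
    simp

theorem norm_le_one {v : ℝ} (hv : 0 ≤ v) {z : ℂ} (hz : z.re = 0) : ‖suppCpow v z‖ ≤ 1 := by
  rw [norm_apply hv, hz]
  split_ifs <;> simp

theorem norm_of_re_eq_one {v : ℝ} (hv : 0 ≤ v) {z : ℂ} (hz : z.re = 1) : ‖suppCpow v z‖ = v := by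
  rw [norm_apply hv, hz]
  split_ifs with h <;> simp [h]

/-- The imaginary parts of the exponents cancel. For `w = 0` the result is the indicator of `v ≠ 0`,
since `0 ^ 0 = 0` here. -/
theorem mul_star {v : ℝ} (z : ℂ) (w : ℝ) (hz : 2 * z.re = w) :
    suppCpow v z * star (suppCpow v z) = suppCpow v w := by
  rw [star_apply, ← add]
  congr 1
  rw [Complex.star_def, Complex.add_conj, hz]

end suppCpow

/-! ### Bounded entire functions on the strip -/

/-- Entire functions that are bounded on the strip `0 ≤ Re z ≤ 1`. -/
def IsStripBounded (f : ℂ → ℂ) : Prop :=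
  Differentiable ℂ f ∧ ∃ C, ∀ z : ℂ, 0 ≤ z.re → z.re ≤ 1 → ‖f z‖ ≤ C

namespace IsStripBounded

theorem const (c : ℂ) : IsStripBounded fun _ => c :=
  ⟨differentiable_const c, ‖c‖, fun _ _ _ => le_rfl⟩

theorem mul {f g : ℂ → ℂ} (hf : IsStripBounded f) (hg : IsStripBounded g) :
    IsStripBounded fun z => f z * g z := by
  obtain ⟨hf, C, hC⟩ := hf
  obtain ⟨hg, D, hD⟩ := hg
  refine ⟨hf.mul hg, C * D, fun z h0 h1 => ?_⟩
  rw [norm_mul]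
  exact mul_le_mul (hC z h0 h1) (hD z h0 h1) (norm_nonneg _) ((norm_nonneg _).trans (hC z h0 h1))

theorem sum {ι : Type*} (s : Finset ι) {f : ι → ℂ → ℂ} (h : ∀ i ∈ s, IsStripBounded (f i)) :
    IsStripBounded fun z => ∑ i ∈ s, f i z := by
  classical
  refine ⟨Differentiable.fun_sum fun i hi => (h i hi).1, ?_⟩
  choose! C hC using fun i hi => (h i hi).2
  exact ⟨∑ i ∈ s, C i, fun z h0 h1 => norm_sum_le_of_le s fun i hi => hC i hi z h0 h1⟩

theorem suppCpow (v : ℝ) (a b : ℝ) : IsStripBounded fun z => suppCpow v (a * z + b) := by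
  by_cases h : v = 0
  · simpa [_root_.suppCpow, h] using const 0
  · simp only [_root_.suppCpow, h, if_false]
    refine ⟨by fun_prop, Real.exp (|Real.log v| * (|a| + |b|)), fun z h0 h1 => ?_⟩
    rw [Complex.norm_exp]
    refine Real.exp_le_exp.2 ?_
    have e : (Real.log v * (a * z + b) : ℂ).re = Real.log v * (a * z.re + b) := by simp
    rw [e]
    refine (le_abs_self _).trans ?_
    rw [abs_mul]
    refine mul_le_mul_of_nonneg_left ((abs_add_le _ _).trans ?_) (abs_nonneg _)
    rw [abs_mul, abs_of_nonneg h0]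
    nlinarith [abs_nonneg a]

/-- Three lines theorem for functions bounded by one on the boundary of the strip. -/
theorem norm_le_one {f : ℂ → ℂ} (hf : IsStripBounded f) (h0 : ∀ z : ℂ, z.re = 0 → ‖f z‖ ≤ 1)
    (h1 : ∀ z : ℂ, z.re = 1 → ‖f z‖ ≤ 1) {z : ℂ} (hz0 : 0 ≤ z.re) (hz1 : z.re ≤ 1) :
    ‖f z‖ ≤ 1 := by
  obtain ⟨hd, C, hC⟩ := hf
  have := Complex.HadamardThreeLines.norm_le_interp_of_mem_verticalClosedStrip₀₁' f (z := z)
    (a := 1) (b := 1) ⟨hz0, hz1⟩ hd.diffContOnCl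
    ⟨C, by rintro _ ⟨w, hw, rfl⟩; exact hC w hw.1 hw.2⟩ (fun w hw => h0 w hw) (fun w hw => h1 w hw)
  simpa using this

variable {l m n : Type*}

theorem matrix_mul [Fintype m] {F : ℂ → Matrix l m ℂ} {G : ℂ → Matrix m n ℂ}
    (hF : ∀ i j, IsStripBounded fun z => F z i j) (hG : ∀ i j, IsStripBounded fun z => G z i j)
    (i : l) (j : n) : IsStripBounded fun z => (F z * G z) i j := by
  simp only [Matrix.mul_apply]
  exact sum (f := fun k z => F z i k * G z k j) _ fun k _ => (hF i k).mul (hG k j)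

theorem unitaryDiag [Fintype n] [DecidableEq n] (U : unitaryGroup n ℂ) {c : ℂ → n → ℂ}
    (hc : ∀ i, IsStripBounded fun z => c z i) (i j : n) :
    IsStripBounded fun z => unitaryDiag U (c z) i j := by
  refine matrix_mul (F := fun z => (U : Matrix n n ℂ) * diagonal (c z))
    (G := fun _ => (U : Matrix n n ℂ)ᴴ) (matrix_mul (F := fun _ => (U : Matrix n n ℂ))
      (G := fun z => diagonal (c z)) (fun _ _ => const _) fun k l => ?_) (fun _ _ => const _) i j
  by_cases h : k = l
  · subst h; simpa using hc k
  · simpa [h] using const 0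

/-- In finite dimension every entry of `Φ (F z)` is a fixed linear combination of the entries of `F
z`. -/
theorem superOp [Fintype m] [DecidableEq m] (Φ : SuperOp m n) {F : ℂ → Matrix m m ℂ}
    (hF : ∀ i j, IsStripBounded fun z => F z i j) (i j : n) :
    IsStripBounded fun z => Φ (F z) i j := by
  have e : ∀ M : Matrix m m ℂ, Φ M i j = ∑ k, ∑ l, M k l * Φ (Matrix.single k l 1) i j := by
    intro M
    conv_lhs => rw [matrix_eq_sum_single M]
    simp only [map_sum, Matrix.sum_apply]
    refine Finset.sum_congr rfl fun k _ => Finset.sum_congr rfl fun l _ => ?_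
    have : Matrix.single k l (M k l) = M k l • Matrix.single k l (1 : ℂ) := by
      simp [Matrix.smul_single]
    rw [this, map_smul, Matrix.smul_apply, smul_eq_mul]
  rw [funext fun z => e (F z)]
  exact sum (f := fun k z => ∑ l, F z k l * Φ (Matrix.single k l 1) i j) _ fun k _ =>
    sum (f := fun l z => F z k l * Φ (Matrix.single k l 1) i j) _ fun l _ =>
      (hF k l).mul (const _)

end IsStripBounded

/-! ### The interpolation inequality -/

/-- Serves the edge `Re z = 0`, where powers with imaginary exponents are contractions: they can be
moved onto the dominating pair, whose traces they do not increase. -/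
theorem Dominated.norm_trace_contraction_le {n : Type*} [Fintype n] [DecidableEq n]
    {P K Q : Matrix n n ℂ} (h : Dominated P K Q) (U V : unitaryGroup n ℂ) {c t : n → ℂ}
    (hc : ∀ i, ‖c i‖ ≤ 1) (ht : ∀ i, ‖t i‖ ≤ 1) :
    2 * ‖(unitaryDiag U c * (unitaryDiag V t * K * unitaryDiag V t)).trace‖ ≤
      P.trace.re + Q.trace.re := by
  have h1 := (h.conj (unitaryDiag V t) (unitaryDiag V t)).conj (unitaryDiag U c) 1
  have h2 := h1.norm_trace_le
  rw [Matrix.mul_one, conjTranspose_one, Matrix.one_mul, Matrix.mul_one] at h2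
  have h3 := unitaryDiag.trace_conj_le U hc (h.conj (unitaryDiag V t) (unitaryDiag V t)).left
  have h4 := unitaryDiag.trace_conj_le V ht h.left
  have h5 := unitaryDiag.trace_conj_le V (c := fun i => star (t i)) (by simpa using ht) h.right
  rw [← unitaryDiag.conjTranspose, conjTranspose_conjTranspose] at h5
  linarith

/-- Trace pairing of an operator of trace norm `∑ w` with a sandwiched operator that is dominated
by `q` times the operator with eigenvalues `t`. -/
theorem Dominated.norm_trace_sandwich_le {n : Type*} [Fintype n] [DecidableEq n]
    {K : Matrix n n ℂ} (U V : unitaryGroup n ℂ) {q : ℝ} (hq : 0 ≤ q) {t w : n → ℝ} {e : n → ℂ}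
    (ht : ∀ i, 0 ≤ t i) (hw : ∀ i, 0 ≤ w i) (he : ∀ i, ‖e i‖ ≤ 1) {z : ℂ} (hz : z.re = 1)
    (h : Dominated ((q : ℂ) • unitaryDiag V fun i => t i) K ((q : ℂ) • unitaryDiag V fun i => t i)) :
    ‖(unitaryDiag U (fun i => e i * suppCpow (w i) z) *
      (unitaryDiag V (fun i => suppCpow (t i) (-z / 2)) * K *
        unitaryDiag V (fun i => suppCpow (t i) (-z / 2)))).trace‖ ≤ q * ∑ i, w i := by
  set T := unitaryDiag V (fun i => suppCpow (t i) (-z / 2)) with hT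
  set R := unitaryDiag V (fun i => suppCpow (t i) ((0 : ℝ) : ℂ)) with hR
  -- As `Re z = 1`, sandwiching cancels `t` exactly and leaves the projection `R` onto its support,
  -- so the sandwiched `K` is dominated by `q R`.
  have key : ∀ i, suppCpow (t i) (-z / 2) * t i * star (suppCpow (t i) (-z / 2)) =
      suppCpow (t i) ((0 : ℝ) : ℂ) := fun i => by
    rw [mul_right_comm, suppCpow.mul_star (w := -1) _ (by simp [hz]; norm_num), ← suppCpow.one (ht i),
      ← suppCpow.add]
    simp
  have h1 := h.conj T T
  have e1 : T * ((q : ℂ) • unitaryDiag V fun i => (t i : ℂ)) * Tᴴ = (q : ℂ) • R := by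
    rw [hT, hR, Matrix.mul_smul, Matrix.smul_mul, unitaryDiag.conjTranspose, unitaryDiag.mul,
      unitaryDiag.mul]
    simp only [key]
  have e2 : Tᴴ * ((q : ℂ) • unitaryDiag V fun i => (t i : ℂ)) * T = (q : ℂ) • R := by
    rw [hT, hR, Matrix.mul_smul, Matrix.smul_mul, unitaryDiag.conjTranspose, unitaryDiag.mul,
      unitaryDiag.mul]
    congr 3
    funext i
    rw [← key i]
    ring
  rw [e1, e2] at h1
  set W₁ := unitaryDiag U (fun i => e i * suppCpow (w i) (z - 1 / 2)) with hW₁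
  -- Balanced splitting: both exponents, `z - 1/2` and `1/2`, have real part `1/2`. By cyclicity one
  -- factor goes on each side of the sandwich, and each dominating operator then has trace at most
  -- `q ∑ w`.
  set W₂ := unitaryDiag U (fun i => suppCpow (w i) (1 / 2)) with hW₂
  have hW : unitaryDiag U (fun i => e i * suppCpow (w i) z) = W₁ * W₂ := by
    rw [hW₁, hW₂, unitaryDiag.mul]
    congr 1
    funext i
    rw [mul_assoc, ← suppCpow.add]
    congr 2
    ring
  have h2 := (h1.conj W₂ W₁).norm_trace_le
  have hsq : ∀ (y : ℂ) (i : n), y.re = 1 / 2 →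
      ‖suppCpow (w i) y‖ ^ 2 = w i := fun y i hy => by
    have h3 := congrArg norm (suppCpow.mul_star (v := w i) y 1 (by rw [hy]; norm_num))
    rw [Complex.ofReal_one, suppCpow.one (hw i), norm_mul, norm_star, Complex.norm_real,
      Real.norm_of_nonneg (hw i)] at h3
    rw [sq, h3]
  have bound : ∀ c : n → ℂ, (∀ i, ‖c i‖ ^ 2 ≤ w i) →
      (unitaryDiag U c * ((q : ℂ) • R) * (unitaryDiag U c)ᴴ).trace.re ≤ q * ∑ i, w i := by
    intro c hc
    have hR1 : R * Rᴴ = R := by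
      rw [hR, unitaryDiag.conjTranspose, unitaryDiag.mul]
      congr 1
      funext i
      rw [suppCpow.mul_star (w := 0) _ (by simp)]
    have h3 := unitaryDiag.trace_conj_le V (c := fun i => star (suppCpow (t i) ((0 : ℝ) : ℂ)))
      (fun i => by rw [norm_star]; exact suppCpow.norm_le_one (ht i) (by simp))
      (posSemidef_conjTranspose_mul_self (unitaryDiag U c))
    rw [← unitaryDiag.conjTranspose, ← hR, conjTranspose_conjTranspose,
      unitaryDiag.conjTranspose U c, unitaryDiag.mul, unitaryDiag.trace] at h3
    have e3 : (unitaryDiag U c * ((q : ℂ) • R) * (unitaryDiag U c)ᴴ).trace =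
        q * (Rᴴ * unitaryDiag U (fun i => star (c i) * c i) * R).trace := by
      rw [Matrix.mul_smul, Matrix.smul_mul, trace_smul, smul_eq_mul]
      congr 1
      rw [trace_mul_cycle, trace_mul_cycle Rᴴ, hR1, unitaryDiag.conjTranspose, unitaryDiag.mul,
        trace_mul_comm]
    rw [e3, Complex.re_ofReal_mul]
    refine mul_le_mul_of_nonneg_left (h3.trans ?_) hq
    rw [Complex.re_sum]
    refine Finset.sum_le_sum fun i _ => ?_
    rw [mul_comm, Complex.star_def, Complex.mul_conj, Complex.ofReal_re, Complex.normSq_eq_norm_sq]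
    exact hc i
  have b1 := bound (fun i => suppCpow (w i) (1 / 2)) fun i => (hsq _ i (by simp)).le
  have b2 := bound (fun i => star (e i * suppCpow (w i) (z - 1 / 2))) fun i => by
    rw [norm_star, norm_mul, mul_pow, hsq _ i (by simp [hz]; norm_num)]
    have : ‖e i‖ ^ 2 ≤ 1 := by nlinarith [he i, norm_nonneg (e i)]
    nlinarith [hw i]
  rw [← unitaryDiag.conjTranspose, conjTranspose_conjTranspose, ← hW₁] at b2
  rw [← hW₂] at b1
  have e4 : (W₂ * (T * K * T) * W₁).trace = (W₁ * W₂ * (T * K * T)).trace := by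
    rw [trace_mul_cycle]
  rw [hW, ← e4]
  linarith

/-- The Stein–Hirschman interpolation step. `θ` is a point of the strip; replacing it by a variable
`z` gives an entire function, bounded on the strip, that is at most one in modulus on both edges. -/
theorem norm_sum_sandwiched_le_one {ι m n : Type*} [Fintype m] [Fintype n] [DecidableEq m]
    [DecidableEq n] (s : Finset ι) {Φ : ι → SuperOp m n} (hΦ : ∀ x, IsCP (Φ x))
    (htr : ∀ P : Matrix m m ℂ, P.PosSemidef → ∑ x ∈ s, (Φ x P).trace.re ≤ P.trace.re)
    (S Y : unitaryGroup m ℂ) {σ v : m → ℝ} {d : m → ℂ} (hσ : ∀ i, 0 ≤ σ i) (hv : ∀ i, 0 ≤ v i)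
    (hv1 : ∑ i, v i ≤ 1) (hd : ∀ i, ‖d i‖ ≤ 1)
    (T W : ι → unitaryGroup n ℂ) {τ w : ι → n → ℝ} {e : ι → n → ℂ} (hτ : ∀ x i, 0 ≤ τ x i)
    (hw : ∀ x i, 0 ≤ w x i) (hw1 : ∀ x, ∑ i, w x i ≤ 1) (he : ∀ x i, ‖e x i‖ ≤ 1)
    {q r : ι → ℝ} (hq : ∀ x ∈ s, 0 ≤ q x) (hr : ∀ x ∈ s, 0 ≤ r x) (hrq : ∑ x ∈ s, r x * q x ≤ 1)
    (hστ : ∀ x ∈ s, Φ x (unitaryDiag S fun i => σ i) = (q x : ℂ) • unitaryDiag (T x) fun i => τ x i)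
    {θ : ℂ} (hθ0 : 0 ≤ θ.re) (hθ1 : θ.re ≤ 1) :
    ‖∑ x ∈ s, suppCpow (r x) θ *
      (unitaryDiag (W x) (fun i => e x i * suppCpow (w x i) θ) *
        (unitaryDiag (T x) (fun i => suppCpow (τ x i) (-θ / 2)) *
          Φ x (unitaryDiag S (fun i => suppCpow (σ i) (θ / 2)) *
            unitaryDiag Y (fun i => d i * suppCpow (v i) (1 - θ)) *
            unitaryDiag S (fun i => suppCpow (σ i) (θ / 2))) *
          unitaryDiag (T x) (fun i => suppCpow (τ x i) (-θ / 2)))).trace‖ ≤ 1 := by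
  let K : ℂ → Matrix m m ℂ := fun z => unitaryDiag S (fun i => suppCpow (σ i) (z / 2)) *
    unitaryDiag Y (fun i => d i * suppCpow (v i) (1 - z)) *
    unitaryDiag S (fun i => suppCpow (σ i) (z / 2))
  let F : ℂ → ℂ := fun z => ∑ x ∈ s, suppCpow (r x) z *
    (unitaryDiag (W x) (fun i => e x i * suppCpow (w x i) z) *
      (unitaryDiag (T x) (fun i => suppCpow (τ x i) (-z / 2)) * Φ x (K z) *
        unitaryDiag (T x) (fun i => suppCpow (τ x i) (-z / 2)))).trace
  have hid : ∀ a : ℝ, IsStripBounded fun z => suppCpow a z := fun a => by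
    simpa using IsStripBounded.suppCpow a 1 0
  have hhalf : ∀ a : ℝ, IsStripBounded fun z => suppCpow a (z / 2) := fun a => by
    have := IsStripBounded.suppCpow a (1 / 2) 0
    convert this using 3
    push_cast; ring
  have hnhalf : ∀ a : ℝ, IsStripBounded fun z => suppCpow a (-z / 2) := fun a => by
    have := IsStripBounded.suppCpow a (-1 / 2) 0
    convert this using 3
    push_cast; ring
  have hrefl : ∀ a : ℝ, IsStripBounded fun z => suppCpow a (1 - z) := fun a => by
    have := IsStripBounded.suppCpow a (-1) 1
    convert this using 3
    push_cast; ring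
  have hK : ∀ i j, IsStripBounded fun z => K z i j :=
    IsStripBounded.matrix_mul (IsStripBounded.matrix_mul
      (IsStripBounded.unitaryDiag S fun i => hhalf _)
      (IsStripBounded.unitaryDiag Y fun i => (IsStripBounded.const _).mul (hrefl _)))
      (IsStripBounded.unitaryDiag S fun i => hhalf _)
  have hF : IsStripBounded F := by
    refine IsStripBounded.sum _ fun x _ => (hid _).mul ?_
    refine IsStripBounded.sum _ fun i _ => ?_
    exact IsStripBounded.matrix_mul
      (IsStripBounded.unitaryDiag (W x) fun i => (IsStripBounded.const _).mul (hid _))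
      (IsStripBounded.matrix_mul (IsStripBounded.matrix_mul
        (IsStripBounded.unitaryDiag (T x) fun i => hnhalf _) (IsStripBounded.superOp (Φ x) hK))
        (IsStripBounded.unitaryDiag (T x) fun i => hnhalf _)) i i
  refine hF.norm_le_one (fun z hz => ?_) (fun z hz => ?_) hθ0 hθ1
  -- Edge `Re z = 0`, trace norm: the input curve is dominated by operators of trace at most one,
  -- all other factors are contractions, and `htr` controls the sum over `x`.
  · have hdom : Dominated (unitaryDiag Y fun i => (v i : ℂ))
        (unitaryDiag Y (fun i => d i * suppCpow (v i) (1 - z)))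
        (unitaryDiag Y fun i => (v i : ℂ)) := unitaryDiag.dominated Y fun i => by
      rw [norm_mul, suppCpow.norm_of_re_eq_one (hv i) (by simp [hz])]
      exact mul_le_of_le_one_left (hv i) (hd i)
    have hc : ∀ i, ‖suppCpow (σ i) (z / 2)‖ ≤ 1 := fun i =>
      suppCpow.norm_le_one (hσ i) (by simp [hz])
    have hvtr : (unitaryDiag Y fun i => (v i : ℂ)).trace.re ≤ 1 := by
      rw [unitaryDiag.trace, Complex.re_sum]
      simpa using hv1
    have h1 := hdom.conj (unitaryDiag S (fun i => suppCpow (σ i) (z / 2)))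
      (unitaryDiag S (fun i => suppCpow (σ i) (z / 2)))
    have tP := (unitaryDiag.trace_conj_le S hc hdom.left).trans hvtr
    have tQ := (unitaryDiag.trace_conj_le S (c := fun i => star (suppCpow (σ i) (z / 2)))
      (by simpa using hc) hdom.right).trans hvtr
    rw [← unitaryDiag.conjTranspose, conjTranspose_conjTranspose] at tQ
    set P := unitaryDiag S (fun i => suppCpow (σ i) (z / 2)) * unitaryDiag Y (fun i => (v i : ℂ)) *
      (unitaryDiag S (fun i => suppCpow (σ i) (z / 2)))ᴴ
    set Q := (unitaryDiag S (fun i => suppCpow (σ i) (z / 2)))ᴴ *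
      unitaryDiag Y (fun i => (v i : ℂ)) * unitaryDiag S (fun i => suppCpow (σ i) (z / 2))
    refine (norm_sum_le _ _).trans ?_
    have h2 : ∀ x ∈ s, 2 * ‖suppCpow (r x) z *
      (unitaryDiag (W x) (fun i => e x i * suppCpow (w x i) z) *
        (unitaryDiag (T x) (fun i => suppCpow (τ x i) (-z / 2)) * Φ x (K z) *
          unitaryDiag (T x) (fun i => suppCpow (τ x i) (-z / 2)))).trace‖ ≤
        (Φ x P).trace.re + (Φ x Q).trace.re := fun x hx => by
      rw [norm_mul]
      refine le_trans (mul_le_mul_of_nonneg_left (mul_le_of_le_one_left (norm_nonneg _)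
        (suppCpow.norm_le_one (hr x hx) hz)) zero_le_two) ?_
      refine (h1.map (hΦ x)).norm_trace_contraction_le (W x) (T x) (fun i => ?_) (fun i => ?_)
      · rw [norm_mul]
        exact mul_le_one₀ (he x i) (norm_nonneg _) (suppCpow.norm_le_one (hw x i) hz)
      · exact suppCpow.norm_le_one (hτ x i) (by simp [hz])
    have h3 := Finset.sum_le_sum h2
    rw [← Finset.mul_sum, Finset.sum_add_distrib] at h3
    have h4 := htr _ h1.left
    have h5 := htr _ h1.right
    linarith
  -- Edge `Re z = 1`, operator norm: the input curve is dominated by the identity, so its sandwich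
  -- is dominated by `σ` and its image by `q x • τ x`. Each pairing is at most `q x`, and the
  -- weights satisfy `∑ r q ≤ 1`.
  · have hdom : Dominated (1 : Matrix m m ℂ)
        (unitaryDiag Y (fun i => d i * suppCpow (v i) (1 - z))) 1 := by
      have := unitaryDiag.dominated Y (a := fun _ => 1)
        (c := fun i => d i * suppCpow (v i) (1 - z)) fun i => by
        rw [norm_mul]
        exact mul_le_one₀ (hd i) (norm_nonneg _) (suppCpow.norm_le_one (hv i) (by simp [hz]))
      simpa only [Complex.ofReal_one, unitaryDiag.one] using this
    have h1 := hdom.conj (unitaryDiag S (fun i => suppCpow (σ i) (z / 2)))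
      (unitaryDiag S (fun i => suppCpow (σ i) (z / 2)))
    have hs : ∀ i, suppCpow (σ i) (z / 2) * star (suppCpow (σ i) (z / 2)) = σ i := fun i => by
      rw [suppCpow.mul_star (w := 1) _ (by simp [hz]), Complex.ofReal_one, suppCpow.one (hσ i)]
    rw [Matrix.mul_one, Matrix.mul_one, unitaryDiag.conjTranspose, unitaryDiag.mul,
      unitaryDiag.mul] at h1
    simp only [mul_comm (star _), hs] at h1
    refine (norm_sum_le _ _).trans (le_trans (Finset.sum_le_sum fun x hx => ?_) hrq)
    rw [norm_mul, suppCpow.norm_of_re_eq_one (hr x hx) hz]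
    refine mul_le_mul_of_nonneg_left ?_ (hr x hx)
    have h2 := h1.map (hΦ x)
    rw [hστ x hx] at h2
    refine (Dominated.norm_trace_sandwich_le (W x) (T x) (hq x hx) (hτ x) (hw x) (he x) hz
      h2).trans ?_
    exact mul_le_of_le_one_right (hq x hx) (hw1 x)

/-! ### Functional calculus and the `α`-norm in an eigenbasis -/

section Spectral

variable {n : Type*} [Fintype n] [DecidableEq n]

theorem cfc_eq_unitaryDiag {H : Matrix n n ℂ} (hH : H.IsHermitian) (f : ℝ → ℝ) :
    cfc f H = unitaryDiag hH.eigenvectorUnitary fun i => f (hH.eigenvalues i) := by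
  rw [hH.cfc_eq, IsHermitian.cfc, Unitary.conjStarAlgAut_apply]
  rfl

theorem eq_unitaryDiag {H : Matrix n n ℂ} (hH : H.IsHermitian) :
    H = unitaryDiag hH.eigenvectorUnitary fun i => hH.eigenvalues i := by
  conv_lhs => rw [hH.spectral_theorem, Unitary.conjStarAlgAut_apply]
  rfl

theorem suppPow_eq_unitaryDiag {σ : Matrix n n ℂ} (hσ : σ.PosSemidef) (s : ℝ) :
    suppPow σ s = unitaryDiag hσ.isHermitian.eigenvectorUnitary
      fun i => suppCpow (hσ.isHermitian.eigenvalues i) s := by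
  rw [suppPow, cfc_eq_unitaryDiag hσ.isHermitian]
  congr 1
  funext i
  rw [suppCpow.ofReal (hσ.eigenvalues_nonneg i)]

theorem isHermitian_suppPow_mul_mul {σ X : Matrix n n ℂ} (hσ : σ.PosSemidef) (hX : X.IsHermitian)
    (s : ℝ) : (suppPow σ s * X * suppPow σ s).IsHermitian := by
  have : (suppPow σ s)ᴴ = suppPow σ s := by
    rw [suppPow_eq_unitaryDiag hσ, unitaryDiag.conjTranspose]
    simp [suppCpow.star_apply]
  have h := isHermitian_mul_mul_conjTranspose (suppPow σ s) hX
  rwa [this] at h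

theorem opAbs_eq_cfc {Y : Matrix n n ℂ} (hY : Y.IsHermitian) :
    opAbs Y = cfc (fun t : ℝ => |t|) Y := by
  have h1 : Yᴴ * Y = cfc (fun t : ℝ => t * t) Y := by
    rw [cfc_eq_unitaryDiag hY, hY.eq]
    conv_lhs => rw [eq_unitaryDiag hY]
    rw [unitaryDiag.mul]
    simp
  rw [opAbs, h1, ← cfc_comp' Real.sqrt (fun t : ℝ => t * t) Y (ha := hY.isSelfAdjoint)]
  simp only [Real.sqrt_mul_self_eq_abs]

theorem alphaNorm_of_ne_top {Y : Matrix n n ℂ} (hY : Y.IsHermitian) {α : ℝ≥0∞} (hα : α ≠ ∞) :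
    alphaNorm α Y = (∑ i, |hY.eigenvalues i| ^ α.toReal) ^ (1 / α.toReal) := by
  rw [alphaNorm, if_neg hα, opAbs_eq_cfc hY,
    ← cfc_comp' (fun t : ℝ => t ^ α.toReal) (fun t : ℝ => |t|) Y
      (hg := ((finite_real_spectrum (A := Y)).image _).continuousOn _) (ha := hY.isSelfAdjoint),
    cfc_eq_unitaryDiag hY, unitaryDiag.trace, Complex.re_sum]
  simp

open scoped Matrix.Norms.L2Operator in
theorem alphaNorm_top {Y : Matrix n n ℂ} (hY : Y.IsHermitian) :
    alphaNorm ∞ Y = ‖hY.eigenvalues‖ := by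
  rw [alphaNorm, if_pos rfl, ← cstar_norm_def]
  conv_lhs => rw [eq_unitaryDiag hY]
  rw [unitaryDiag, ← star_eq_conjTranspose, CStarRing.norm_mul_mem_unitary _
    (Unitary.star_mem hY.eigenvectorUnitary.2), CStarRing.norm_coe_unitary_mul, l2_opNorm_diagonal]
  simp [Pi.norm_def]

end Spectral

theorem one_sub_toReal_inv_mem {α : ℝ≥0∞} (hα : 1 ≤ α) :
    0 ≤ 1 - α⁻¹.toReal ∧ 1 - α⁻¹.toReal ≤ 1 := by
  have : α⁻¹.toReal ≤ 1 := by
    have := ENNReal.toReal_mono ENNReal.one_ne_top (ENNReal.inv_le_one.2 hα)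
    simpa using this
  exact ⟨by linarith, by linarith [ENNReal.toReal_nonneg (a := α⁻¹)]⟩

theorem alphaNorm_nonneg {n : Type*} [Fintype n] [DecidableEq n] {Y : Matrix n n ℂ}
    (hY : Y.IsHermitian) (α : ℝ≥0∞) : 0 ≤ alphaNorm α Y := by
  by_cases h : α = ∞
  · subst h; rw [alphaNorm_top hY]; exact norm_nonneg _
  · rw [alphaNorm_of_ne_top hY h]
    exact Real.rpow_nonneg (Finset.sum_nonneg fun i _ => Real.rpow_nonneg (abs_nonneg _) _) _

theorem sum_rpow_eigenvalues {n : Type*} [Fintype n] [DecidableEq n] {Y : Matrix n n ℂ}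
    (hY : Y.IsHermitian) {α : ℝ≥0∞} (h1 : 1 ≤ α) (hα : α ≠ ∞) :
    ∑ i, |hY.eigenvalues i| ^ α.toReal = alphaNorm α Y ^ α.toReal := by
  have h0 : α.toReal ≠ 0 := (ENNReal.toReal_pos (by positivity) hα).ne'
  rw [alphaNorm_of_ne_top hY hα, ← Real.rpow_mul (Finset.sum_nonneg fun i _ =>
    Real.rpow_nonneg (abs_nonneg _) _), one_div_mul_cancel h0, Real.rpow_one]

theorem eigenvalues_eq_zero_of_alphaNorm_eq_zero {n : Type*} [Fintype n] [DecidableEq n]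
    {Y : Matrix n n ℂ} (hY : Y.IsHermitian) {α : ℝ≥0∞} (h1 : 1 ≤ α) (h : alphaNorm α Y = 0)
    (i : n) : hY.eigenvalues i = 0 := by
  by_cases hα : α = ∞
  · subst hα
    rw [alphaNorm_top hY, norm_eq_zero] at h
    exact congrFun h i
  · have h0 : α.toReal ≠ 0 := (ENNReal.toReal_pos (by positivity) hα).ne'
    have h2 := sum_rpow_eigenvalues hY h1 hα
    rw [h, Real.zero_rpow h0, Finset.sum_eq_zero_iff_of_nonneg
      (fun i _ => Real.rpow_nonneg (abs_nonneg _) _)] at h2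
    have := h2 i (Finset.mem_univ i)
    rw [Real.rpow_eq_zero (abs_nonneg _) h0] at this
    exact abs_eq_zero.1 this

theorem eq_zero_of_alphaNorm_eq_zero {n : Type*} [Fintype n] [DecidableEq n]
    {Y : Matrix n n ℂ} (hY : Y.IsHermitian) {α : ℝ≥0∞} (h1 : 1 ≤ α) (h : alphaNorm α Y = 0) :
    Y = 0 := by
  rw [eq_unitaryDiag hY]
  simp [eigenvalues_eq_zero_of_alphaNorm_eq_zero hY h1 h, unitaryDiag]

/-- Every Hermitian operator lies on an interpolation curve through the unit balls. -/
theorem exists_interpolation {n : Type*} [Fintype n] [DecidableEq n] {Y : Matrix n n ℂ}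
    (hY : Y.IsHermitian) {α : ℝ≥0∞} (h1 : 1 ≤ α) :
    ∃ (U : unitaryGroup n ℂ) (d : n → ℂ) (v : n → ℝ), (∀ i, ‖d i‖ ≤ 1) ∧ (∀ i, 0 ≤ v i) ∧
      ∑ i, v i ≤ 1 ∧ Y = (alphaNorm α Y : ℂ) •
        unitaryDiag U (fun i => d i * suppCpow (v i) (1 - ((1 - α⁻¹.toReal : ℝ) : ℂ))) := by
  set N := alphaNorm α Y with hN
  set y := hY.eigenvalues with hy
  have hN0 : 0 ≤ N := alphaNorm_nonneg hY α
  have hexp : (1 - ((1 - α⁻¹.toReal : ℝ) : ℂ)) = ((α⁻¹.toReal : ℝ) : ℂ) := by push_cast; ring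
  suffices H : ∃ (d v : n → ℝ), (∀ i, |d i| ≤ 1) ∧ (∀ i, 0 ≤ v i) ∧ ∑ i, v i ≤ 1 ∧
      ∀ i, y i = N * (d i * if v i = 0 then 0 else v i ^ α⁻¹.toReal) by
    obtain ⟨d, v, hd, hv, hv1, h⟩ := H
    refine ⟨hY.eigenvectorUnitary, fun i => d i, v, by simpa using hd, hv, hv1, ?_⟩
    conv_lhs => rw [eq_unitaryDiag hY]
    rw [unitaryDiag.smul]
    congr 1
    funext i
    rw [hexp, suppCpow.ofReal (hv i), ← hy, h i]
    push_cast
    rfl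
  rcases hN0.eq_or_lt with h0 | hpos
  · refine ⟨0, 0, by simp, by simp, by simp, fun i => ?_⟩
    rw [hy, eigenvalues_eq_zero_of_alphaNorm_eq_zero hY h1 h0.symm i]
    simp
  by_cases hα : α = ∞
  · subst hα
    have hle : ∀ i, |y i| ≤ N := fun i => by
      rw [hN, alphaNorm_top hY]; exact norm_le_pi_norm hY.eigenvalues i
    -- For `α = ∞` the exponent is `0`, so any nonvanishing `v` contributes the factor one; the
    -- uniform distribution also has the required sum.
    refine ⟨fun i => y i / N, fun _ => (Fintype.card n : ℝ)⁻¹, fun i => ?_, fun i => by positivity,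
      ?_, fun i => ?_⟩
    · rw [abs_div, abs_of_pos hpos, div_le_one hpos]; exact hle i
    · rw [Finset.sum_const, Finset.card_univ, nsmul_eq_mul]
      exact mul_inv_le_one
    · have : Nonempty n := ⟨i⟩
      simp
      field_simp
  · have hp : 0 < α.toReal := ENNReal.toReal_pos (by positivity) hα
    have hNp : 0 < N ^ α.toReal := Real.rpow_pos_of_pos hpos _
    -- Polar decomposition of each eigenvalue: `v ^ (1/α) = |y| / N`, with the sign carried by `d`.
    refine ⟨fun i => SignType.sign (y i), fun i => |y i| ^ α.toReal / N ^ α.toReal, fun i => ?_,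
      fun i => by positivity, ?_, fun i => ?_⟩
    · rcases lt_trichotomy (y i) 0 with h | h | h <;> simp [h]
    · rw [← Finset.sum_div, sum_rpow_eigenvalues hY h1 hα, div_self hNp.ne']
    · by_cases hyi : y i = 0
      · simp [hyi]
      · have hv : |y i| ^ α.toReal / N ^ α.toReal ≠ 0 :=
          (div_pos (Real.rpow_pos_of_pos (abs_pos.2 hyi) _) hNp).ne'
        dsimp only
        rw [if_neg hv, ← Real.div_rpow (abs_nonneg _) hpos.le, ← Real.rpow_mul (by positivity),
          ENNReal.toReal_inv, mul_inv_cancel₀ hp.ne', Real.rpow_one]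
        have := sign_mul_abs (y i)
        field_simp
        linarith

/-- Every Hermitian operator has a norming functional that lies on an interpolation curve. -/
theorem exists_dual_interpolation {n : Type*} [Fintype n] [DecidableEq n] {Y : Matrix n n ℂ}
    (hY : Y.IsHermitian) {α : ℝ≥0∞} (h1 : 1 ≤ α) :
    ∃ (U : unitaryGroup n ℂ) (e : n → ℂ) (w : n → ℝ), (∀ i, ‖e i‖ ≤ 1) ∧ (∀ i, 0 ≤ w i) ∧
      ∑ i, w i ≤ 1 ∧ (unitaryDiag U (fun i => e i * suppCpow (w i) ((1 - α⁻¹.toReal : ℝ) : ℂ)) *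
        Y).trace = alphaNorm α Y := by
  set N := alphaNorm α Y with hN
  set y := hY.eigenvalues with hy
  have hN0 : 0 ≤ N := alphaNorm_nonneg hY α
  suffices H : ∃ (e w : n → ℝ), (∀ i, |e i| ≤ 1) ∧ (∀ i, 0 ≤ w i) ∧ ∑ i, w i ≤ 1 ∧
      ∑ i, e i * (if w i = 0 then 0 else w i ^ (1 - α⁻¹.toReal)) * y i = N by
    obtain ⟨e, w, he, hw, hw1, h⟩ := H
    refine ⟨hY.eigenvectorUnitary, fun i => e i, w, by simpa using he, hw, hw1, ?_⟩
    refine (congrArg (fun M => (unitaryDiag hY.eigenvectorUnitary (fun i => (e i : ℂ) *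
      suppCpow (w i) ((1 - α⁻¹.toReal : ℝ) : ℂ)) * M).trace) (eq_unitaryDiag hY)).trans ?_
    rw [unitaryDiag.mul, unitaryDiag.trace, ← h]
    simp only [suppCpow.ofReal (hw _)]
    push_cast
    rfl
  rcases hN0.eq_or_lt with h0 | hpos
  · exact ⟨0, 0, by simp, by simp, by simp, by simp [← h0]⟩
  have hsign : ∀ i, |((SignType.sign (y i) : SignType) : ℝ)| ≤ 1 := fun i => by
    rcases lt_trichotomy (y i) 0 with h | h | h <;> simp [h]
  by_cases hα : α = ∞
  · subst hα
    have hN' : N = ‖y‖ := by rw [hN, alphaNorm_top hY]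
    -- For `α = ∞` the dual exponent is `1`, and the norming functional is the signed projection
    -- onto an eigenvector whose eigenvalue has maximal modulus.
    obtain ⟨i, hi⟩ : ∃ i, |y i| = N := by
      by_contra! hne
      have : ‖y‖ < N := (pi_norm_lt_iff hpos).2 fun i =>
        lt_of_le_of_ne (by rw [hN']; exact norm_le_pi_norm y i) (hne i)
      exact this.ne hN'.symm
    refine ⟨fun i => SignType.sign (y i), fun j => if j = i then 1 else 0, hsign, fun j => ?_, ?_,
      ?_⟩
    · dsimp only; split_ifs <;> norm_num
    · simp
    · rw [Finset.sum_eq_single i]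
      · simp [sign_mul_self, hi]
      · intro j _ hj; simp [hj]
      · simp
  · have hp : 0 < α.toReal := ENNReal.toReal_pos (by positivity) hα
    have hNp : 0 < N ^ α.toReal := Real.rpow_pos_of_pos hpos _
    -- The equality case of Hölder: `w ^ (1 - 1/α)` is proportional to `|y| ^ (α - 1)` where `y ≠
    -- 0`.
    refine ⟨fun i => SignType.sign (y i), fun i => |y i| ^ α.toReal / N ^ α.toReal, hsign,
      fun i => by positivity, ?_, ?_⟩
    · rw [← Finset.sum_div, sum_rpow_eigenvalues hY h1 hα, div_self hNp.ne']
    · have key : ∀ i, (SignType.sign (y i) : ℝ) * (if |y i| ^ α.toReal / N ^ α.toReal = 0 then 0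
          else (|y i| ^ α.toReal / N ^ α.toReal) ^ (1 - α⁻¹.toReal)) * y i =
          |y i| ^ α.toReal / N ^ α.toReal * N := by
        intro i
        by_cases hyi : y i = 0
        · simp [hyi, Real.zero_rpow hp.ne']
        · have hv : 0 < |y i| ^ α.toReal / N ^ α.toReal :=
            div_pos (Real.rpow_pos_of_pos (abs_pos.2 hyi) _) hNp
          have e1 : (|y i| ^ α.toReal / N ^ α.toReal) ^ α⁻¹.toReal = |y i| / N := by
            rw [← Real.div_rpow (abs_nonneg _) hpos.le, ← Real.rpow_mul (by positivity),
              ENNReal.toReal_inv, mul_inv_cancel₀ hp.ne', Real.rpow_one]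
          rw [if_neg hv.ne', Real.rpow_sub hv, Real.rpow_one, e1, mul_right_comm, sign_mul_self]
          have := abs_pos.2 hyi
          field_simp
      rw [Finset.sum_congr rfl fun i _ => key i, ← Finset.sum_mul, ← Finset.sum_div,
        sum_rpow_eigenvalues hY h1 hα, div_self hNp.ne', one_mul]

/-! ### Supports -/

section Support

variable {m n : Type*} [Fintype m] [DecidableEq m] [Fintype n] [DecidableEq n]

theorem opSupport_le_iff {X σ : Matrix n n ℂ} :
    opSupport X ≤ opSupport σ ↔ ∀ v, σ *ᵥ v = 0 → X *ᵥ v = 0 := by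
  rw [opSupport, opSupport, Submodule.orthogonal_le_orthogonal_iff]
  constructor
  · intro h v hv
    have := @h (WithLp.toLp 2 v) (by
      rw [LinearMap.mem_ker]; ext i; simp [toLpLin_apply, hv])
    rw [LinearMap.mem_ker] at this
    simpa [toLpLin_apply] using this
  · intro h v hv
    rw [LinearMap.mem_ker] at hv ⊢
    have := h v.ofLp (by simpa [toLpLin_apply] using hv)
    simpa [toLpLin_apply] using this

/-- Opposite powers of `σ` multiply to its support projection `R`. Support inclusion gives `X R =
X`, and taking adjoints gives `R X = X`. -/
theorem sandwich_cancel {X σ : Matrix n n ℂ} (hσ : σ.PosSemidef) (hX : X.IsHermitian)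
    (h : opSupport X ≤ opSupport σ) (s : ℝ) :
    suppPow σ s * (suppPow σ (-s) * X * suppPow σ (-s)) * suppPow σ s = X := by
  set R := unitaryDiag hσ.isHermitian.eigenvectorUnitary
    fun i => suppCpow (hσ.isHermitian.eigenvalues i) 0 with hR
  have h1 : suppPow σ s * suppPow σ (-s) = R := by
    rw [suppPow_eq_unitaryDiag hσ, suppPow_eq_unitaryDiag hσ, unitaryDiag.mul]
    simp [← suppCpow.add, hR]
  have h2 : suppPow σ (-s) * suppPow σ s = R := by
    rw [suppPow_eq_unitaryDiag hσ, suppPow_eq_unitaryDiag hσ, unitaryDiag.mul]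
    simp [← suppCpow.add, hR]
  have hRR : Rᴴ = R := by
    rw [hR, unitaryDiag.conjTranspose]
    simp [suppCpow.star_apply]
  have h3 : σ * (1 - R) = 0 := by
    rw [Matrix.mul_sub, Matrix.mul_one, sub_eq_zero]
    conv_lhs => rw [eq_unitaryDiag hσ.isHermitian]
    conv_rhs => rw [eq_unitaryDiag hσ.isHermitian]
    rw [hR, unitaryDiag.mul]
    congr 1
    funext i
    rw [← suppCpow.one (hσ.eigenvalues_nonneg i), ← suppCpow.add, add_zero]
  have h4 : X * (1 - R) = 0 := by
    refine Matrix.ext_of_mulVec_single fun i => ?_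
    rw [← mulVec_mulVec, zero_mulVec]
    apply opSupport_le_iff.1 h
    rw [mulVec_mulVec, h3, zero_mulVec]
  have h5 : X * R = X := by
    rw [Matrix.mul_sub, Matrix.mul_one, sub_eq_zero] at h4
    exact h4.symm
  have h6 : R * X = X := by
    have := congrArg conjTranspose h5
    rwa [conjTranspose_mul, hRR, hX.eq] at this
  calc _ = (suppPow σ s * suppPow σ (-s)) * X * (suppPow σ (-s) * suppPow σ s) := by
        simp only [Matrix.mul_assoc]
    _ = X := by rw [h1, h2, h6, h5]

/-- Turns support inclusion into a relation that completely positive maps preserve. The constant is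
a crude bound, the sum of the moduli of the eigenvalues of `σ^(-1/2) X σ^(-1/2)`. -/
theorem exists_dominated_of_opSupport_le {X σ : Matrix n n ℂ} (hσ : σ.PosSemidef)
    (hX : X.IsHermitian) (h : opSupport X ≤ opSupport σ) :
    ∃ c : ℂ, Dominated (c • σ) X (c • σ) := by
  set Z := suppPow σ (-(1 / 2)) * X * suppPow σ (-(1 / 2)) with hZ
  have hZh : Z.IsHermitian := isHermitian_suppPow_mul_mul hσ hX _
  set c : ℝ := ∑ i, |hZh.eigenvalues i|
  have h1 := unitaryDiag.dominated hZh.eigenvectorUnitary (a := fun _ => c)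
    (c := fun i => hZh.eigenvalues i) fun i => by
      rw [Complex.norm_real]
      exact Finset.single_le_sum (f := fun i => |hZh.eigenvalues i|) (fun i _ => abs_nonneg _)
        (Finset.mem_univ i)
  have h2 : (unitaryDiag hZh.eigenvectorUnitary fun _ => (c : ℂ)) = (c : ℂ) • 1 := by
    rw [← unitaryDiag.one hZh.eigenvectorUnitary, unitaryDiag.smul]
    simp
  have hs : (suppPow σ (1 / 2))ᴴ = suppPow σ (1 / 2) := by
    rw [suppPow_eq_unitaryDiag hσ, unitaryDiag.conjTranspose]
    simp [suppCpow.star_apply]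
  have hss : suppPow σ (1 / 2) * suppPow σ (1 / 2) = σ := by
    conv_rhs => rw [eq_unitaryDiag hσ.isHermitian]
    rw [suppPow_eq_unitaryDiag hσ, unitaryDiag.mul]
    congr 1
    funext i
    rw [← suppCpow.add, ← suppCpow.one (hσ.eigenvalues_nonneg i)]
    congr 1
    push_cast
    ring
  rw [← eq_unitaryDiag hZh, h2] at h1
  have h3 := h1.conj (suppPow σ (1 / 2)) (suppPow σ (1 / 2))
  rw [sandwich_cancel hσ hX h, hs, Matrix.mul_smul, Matrix.smul_mul, Matrix.mul_one, hss] at h3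
  exact ⟨c, h3⟩

theorem opSupport_map_le {Φ : SuperOp m n} (hΦ : IsCP Φ) {X σ : Matrix m m ℂ} (hσ : σ.PosSemidef)
    (hX : X.IsHermitian) (h : opSupport X ≤ opSupport σ) :
    opSupport (Φ X) ≤ opSupport (Φ σ) := by
  obtain ⟨c, hc⟩ := exists_dominated_of_opSupport_le hσ hX h
  refine opSupport_le_iff.2 fun v hv => (hc.map hΦ).mulVec_eq_zero ?_
  rw [map_smul, smul_mulVec, hv, smul_zero]

end Support

/-! ### Completely positive maps and LOCC instruments -/

namespace IsCP

variable {l m n : Type*}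

theorem posSemidef_idTensor {Φ : SuperOp m n} (hΦ : IsCP Φ) (R : Type*) [Fintype R]
    {M : Matrix (R × m) (R × m) ℂ} (hM : M.PosSemidef) : (idTensor R Φ M).PosSemidef := by
  let e := Fintype.equivFin R
  have h := (hΦ _ _ (hM.submatrix (Prod.map e.symm id))).submatrix (Prod.map e id)
  convert h using 1
  ext i j
  simp [idTensor]

theorem posSemidef_map {Φ : SuperOp m n} (hΦ : IsCP Φ) {M : Matrix m m ℂ} (hM : M.PosSemidef) :
    (Φ M).PosSemidef :=
  (hΦ.posSemidef_idTensor Unit (hM.submatrix Prod.snd)).submatrix (fun i : n => ((), i))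

theorem comp {Ψ : SuperOp m n} {Φ : SuperOp l m} (hΨ : IsCP Ψ) (hΦ : IsCP Φ) :
    IsCP (Ψ ∘ₗ Φ) :=
  fun k M hM => hΨ k _ (hΦ k M hM)

theorem sum {ι : Type*} (s : Finset ι) {Φ : ι → SuperOp m n} (h : ∀ i ∈ s, IsCP (Φ i)) :
    IsCP (∑ i ∈ s, Φ i) := by
  intro k M hM
  have e : idTensor (Fin k) (∑ i ∈ s, Φ i) M = ∑ i ∈ s, idTensor (Fin k) (Φ i) M := by
    ext i j
    simp [idTensor, LinearMap.sum_apply, Matrix.sum_apply]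
  rw [e]
  exact posSemidef_sum s fun i hi => h i hi k M hM

theorem tensorId {Φ : SuperOp m n} (hΦ : IsCP Φ) (R : Type*) [Fintype R] :
    IsCP (tensorId R Φ) := by
  intro k M hM
  exact (hΦ.posSemidef_idTensor (Fin k × R) (hM.submatrix
    (fun i : (Fin k × R) × m => (i.1.1, i.2, i.1.2)))).submatrix
    (fun i : Fin k × n × R => ((i.1, i.2.2), i.2.1))

theorem idTensor {Φ : SuperOp m n} (hΦ : IsCP Φ) (R : Type*) [Fintype R] :
    IsCP (idTensor R Φ) := by
  intro k M hM
  exact (hΦ.posSemidef_idTensor (Fin k × R) (hM.submatrix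
    (fun i : (Fin k × R) × m => (i.1.1, i.1.2, i.2)))).submatrix
    (fun i : Fin k × R × n => ((i.1, i.2.1), i.2.2))

/-- Transposition of the systems on which the map acts trivially commutes with it. Conjugating by
the partial transpose is therefore the same as conjugating by the full transpose, which preserves
positivity. -/
theorem partialTransposeB_idTensor {Φ : SuperOp m n} (hΦ : IsCP Φ) (R : Type*) [Fintype R] :
    IsCP (partialTransposeB R n ∘ₗ _root_.idTensor R Φ ∘ₗ partialTransposeB R m) := by
  intro k M hM
  exact ((hΦ.posSemidef_idTensor (Fin k × R) (hM.submatrix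
    (fun i : (Fin k × R) × m => (i.1.1, i.1.2, i.2))).transpose).transpose).submatrix
    (fun i : Fin k × R × n => ((i.1, i.2.1), i.2.2))

end IsCP

theorem trace_partialTransposeB {A B : Type*} [Fintype A] [Fintype B]
    (M : Matrix (A × B) (A × B) ℂ) : (partialTransposeB A B M).trace = M.trace := rfl

theorem partialTransposeB_partialTransposeB {A B : Type*} (M : Matrix (A × B) (A × B) ℂ) :
    partialTransposeB A B (partialTransposeB A B M) = M := rfl

theorem IsInstrument.isCPPTPInstrument_tensorId {X A A' B : Type*} [Fintype X] [Fintype A]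
    [Fintype A'] [Fintype B] {N : X → SuperOp A A'} (hN : IsInstrument N) :
    IsCPPTPInstrument (fun x => (tensorId B (N x) : SuperOp (A × B) (A' × B))) := by
  -- Alice's maps commute with `T_B`, so the conjugated map is definitionally the original one.
  refine ⟨fun x => (hN.1 x).tensorId B, fun x => (hN.1 x).tensorId B, fun M => ?_⟩
  have h : ∀ b, ∑ i, ∑ x, N x (of fun k l => M (k, b) (l, b)) i i = ∑ i, M (i, b) (i, b) := by
    intro b
    have := hN.2 (of fun k l => M (k, b) (l, b))
    simpa [Matrix.trace, LinearMap.sum_apply, Matrix.sum_apply] using this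
  simp only [Matrix.trace, LinearMap.sum_apply, Matrix.diag_apply, Matrix.sum_apply,
    Fintype.sum_prod_type_right]
  exact Finset.sum_congr rfl fun b _ => h b

theorem IsInstrument.isCPPTPInstrument_idTensor {X A B B' : Type*} [Fintype X] [Fintype A]
    [Fintype B] [Fintype B'] {N : X → SuperOp B B'} (hN : IsInstrument N) :
    IsCPPTPInstrument (fun x => (idTensor A (N x) : SuperOp (A × B) (A × B'))) := by
  refine ⟨fun x => (hN.1 x).idTensor A, fun x => (hN.1 x).partialTransposeB_idTensor A,
    fun M => ?_⟩
  have h : ∀ a, ∑ i, ∑ x, N x (of fun k l => M (a, k) (a, l)) i i = ∑ i, M (a, i) (a, i) := by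
    intro a
    have := hN.2 (of fun k l => M (a, k) (a, l))
    simpa [Matrix.trace, LinearMap.sum_apply, Matrix.sum_apply] using this
  simp only [Matrix.trace, LinearMap.sum_apply, Matrix.diag_apply, Matrix.sum_apply,
    Fintype.sum_prod_type]
  exact Finset.sum_congr rfl fun a _ => h a

theorem IsCPPTPInstrument.comp {X Y A B A₁ B₁ A' B' : Type*} [Fintype X] [Fintype Y] [Fintype A]
    [Fintype B] [Fintype A₁] [Fintype B₁] [Fintype A'] [Fintype B']
    {N : X → SuperOp (A × B) (A₁ × B₁)} {M : X → Y → SuperOp (A₁ × B₁) (A' × B')}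
    (hN : IsCPPTPInstrument N) (hM : ∀ x, IsCPPTPInstrument (M x)) :
    IsCPPTPInstrument (fun p : X × Y => M p.1 p.2 ∘ₗ N p.1) := by
  refine ⟨fun p => ((hM p.1).1 p.2).comp (hN.1 p.1), fun p => ?_, fun P => ?_⟩
  · have e : partialTransposeB A' B' ∘ₗ (M p.1 p.2 ∘ₗ N p.1) ∘ₗ partialTransposeB A B =
        (partialTransposeB A' B' ∘ₗ M p.1 p.2 ∘ₗ partialTransposeB A₁ B₁) ∘ₗ
          (partialTransposeB A₁ B₁ ∘ₗ N p.1 ∘ₗ partialTransposeB A B) := by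
      refine LinearMap.ext fun P => ?_
      simp only [LinearMap.comp_apply, partialTransposeB_partialTransposeB]
    rw [e]
    exact ((hM p.1).2.1 p.2).comp (hN.2.1 p.1)
  have h1 := hN.2.2 P
  have h2 := fun x => (hM x).2.2 (N x P)
  simp only [LinearMap.sum_apply, trace_sum] at h1 h2 ⊢
  rw [Fintype.sum_prod_type, ← h1]
  exact Finset.sum_congr rfl fun x _ => h2 x

theorem IsCPPTPInstrument.coarseGrain {X Z A B A' B' : Type*} [Fintype X] [Fintype Z]
    [DecidableEq Z] [Fintype A] [Fintype B] [Fintype A'] [Fintype B']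
    {N : X → SuperOp (A × B) (A' × B')} (hN : IsCPPTPInstrument N) (f : X → Z) :
    IsCPPTPInstrument (fun z => ∑ x with f x = z, N x) := by
  refine ⟨fun z => IsCP.sum _ fun x _ => hN.1 x, fun z => ?_, ?_⟩
  · have e : partialTransposeB A' B' ∘ₗ (∑ x with f x = z, N x) ∘ₗ partialTransposeB A B =
        ∑ x with f x = z, partialTransposeB A' B' ∘ₗ N x ∘ₗ partialTransposeB A B := by
      refine LinearMap.ext fun M => ?_
      simp [LinearMap.sum_apply]
    rw [e]
    exact IsCP.sum _ fun x _ => hN.2.1 x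
  · rw [Finset.sum_fiberwise]
    exact hN.2.2

/-- The `Fintype` instances are quantified inside the conclusion because `IsLOCC` stores its own in
each constructor; the induction first identifies the two sets of instances. -/
theorem IsLOCC.isCPPTPInstrument {X A B A' B' : Type u} {N : X → SuperOp (A × B) (A' × B')}
    (h : IsLOCC N) : ∀ [Fintype X] [Fintype A] [Fintype B] [Fintype A'] [Fintype B'],
    IsCPPTPInstrument N := by
  induction h with
  | @alice _ _ _ _ j₁ j₂ j₃ j₄ N hN =>
    intro i₁ i₂ i₃ i₄ i₅
    obtain rfl := Subsingleton.elim i₁ j₁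
    obtain rfl := Subsingleton.elim i₂ j₂
    obtain rfl := Subsingleton.elim i₄ j₃
    obtain rfl := Subsingleton.elim i₃ j₄
    obtain rfl := Subsingleton.elim i₅ i₃
    exact hN.isCPPTPInstrument_tensorId
  | @bob _ _ _ _ j₁ j₂ j₃ j₄ N hN =>
    intro i₁ i₂ i₃ i₄ i₅
    obtain rfl := Subsingleton.elim i₁ j₁
    obtain rfl := Subsingleton.elim i₂ j₂
    obtain rfl := Subsingleton.elim i₃ j₃
    obtain rfl := Subsingleton.elim i₅ j₄
    obtain rfl := Subsingleton.elim i₄ i₂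
    exact hN.isCPPTPInstrument_idTensor
  | @comp _ _ _ _ _ _ _ _ j₁ j₂ _ _ _ _ _ _ N M hN hM ihN ihM =>
    intro i₁ i₂ i₃ i₄ i₅
    obtain rfl := Subsingleton.elim i₁ (@instFintypeProd _ _ j₁ j₂)
    exact IsCPPTPInstrument.comp ihN fun x => ihM x
  | @coarseGrain _ _ _ _ _ _ _ j₂ _ _ _ _ _ N hN f ih =>
    intro i₁ i₂ i₃ i₄ i₅
    obtain rfl := Subsingleton.elim i₁ j₂
    exact IsCPPTPInstrument.coarseGrain ih f

/-! ### Monotonicity of `μ_α` under families of completely positive maps -/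

/-- Interpolation at `θ = 1 - 1/α`: with the input normalized by its norm and every output paired
with its norming functional, the interpolated sum is exactly the left side divided by the norm on
the right. The weights `r` are left free, to be taken as `p / q`. -/
theorem sum_rpow_mul_alphaNorm_le {ι m n : Type*} [Fintype m] [Fintype n] [DecidableEq m]
    [DecidableEq n] (s : Finset ι) {Φ : ι → SuperOp m n} (hΦ : ∀ x, IsCP (Φ x))
    (htr : ∀ P : Matrix m m ℂ, P.PosSemidef → ∑ x ∈ s, (Φ x P).trace.re ≤ P.trace.re)
    {σ X : Matrix m m ℂ} (hσ : σ.PosSemidef) (hX : X.IsHermitian)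
    (hsupp : opSupport X ≤ opSupport σ) {τ ξ : ι → Matrix n n ℂ} (hτ : ∀ x, (τ x).PosSemidef)
    (hξ : ∀ x, (ξ x).IsHermitian) {p q r : ι → ℝ} (hq : ∀ x ∈ s, 0 ≤ q x) (hr : ∀ x ∈ s, 0 < r x)
    (hrq : ∑ x ∈ s, r x * q x ≤ 1) (hστ : ∀ x ∈ s, Φ x σ = (q x : ℂ) • τ x)
    (hXξ : ∀ x ∈ s, Φ x X = (p x : ℂ) • ξ x) {α : ℝ≥0∞} (hα : 1 ≤ α) :
    ∑ x ∈ s, r x ^ (1 - α⁻¹.toReal) * (p x * alphaNorm α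
      (suppPow (τ x) (sandwichExponent α) * ξ x * suppPow (τ x) (sandwichExponent α))) ≤
    alphaNorm α (suppPow σ (sandwichExponent α) * X * suppPow σ (sandwichExponent α)) := by
  set θ : ℝ := 1 - α⁻¹.toReal with hθ
  have hexp : sandwichExponent α = -(θ / 2) := by rw [sandwichExponent, hθ]; ring
  have hZ := isHermitian_suppPow_mul_mul hσ hX (sandwichExponent α)
  have hZx := fun x => isHermitian_suppPow_mul_mul (hτ x) (hξ x) (sandwichExponent α)
  set N := alphaNorm α (suppPow σ (sandwichExponent α) * X * suppPow σ (sandwichExponent α)) with hN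
  have hN0 : 0 ≤ N := alphaNorm_nonneg hZ α
  obtain ⟨Y, d, v, hd, hv, hv1, hY⟩ := exists_interpolation hZ hα
  choose W e w he hw hw1 hW using fun x => exists_dual_interpolation (hZx x) hα
  have hmain := norm_sum_sandwiched_le_one s hΦ htr hσ.isHermitian.eigenvectorUnitary Y
    hσ.eigenvalues_nonneg hv hv1 hd (fun x => (hτ x).isHermitian.eigenvectorUnitary) W
    (fun x => (hτ x).eigenvalues_nonneg) hw hw1 he hq (fun x hx => (hr x hx).le) hrq
    (fun x hx => by rw [← eq_unitaryDiag hσ.isHermitian, hστ x hx, ← eq_unitaryDiag])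
    (θ := (θ : ℂ)) (one_sub_toReal_inv_mem hα).1 (one_sub_toReal_inv_mem hα).2
  have hS : (unitaryDiag hσ.isHermitian.eigenvectorUnitary fun i =>
      suppCpow (hσ.isHermitian.eigenvalues i) ((θ : ℂ) / 2)) = suppPow σ (θ / 2) := by
    rw [suppPow_eq_unitaryDiag hσ]
    push_cast
    rfl
  have hT : ∀ x, (unitaryDiag (hτ x).isHermitian.eigenvectorUnitary fun i =>
      suppCpow ((hτ x).isHermitian.eigenvalues i) (-(θ : ℂ) / 2)) =
      suppPow (τ x) (sandwichExponent α) := fun x => by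
    rw [suppPow_eq_unitaryDiag (hτ x), hexp]
    push_cast
    rw [neg_div]
  simp only [hS, hT] at hmain
  set K := suppPow σ (θ / 2) * (unitaryDiag Y fun i => d i * suppCpow (v i) (1 - (θ : ℂ))) *
    suppPow σ (θ / 2) with hK
  have hXK : X = (N : ℂ) • K := by
    rw [hK, ← Matrix.smul_mul, ← Matrix.mul_smul, ← hY, hexp, sandwich_cancel hσ hX hsupp]
  have hterm : ∀ x ∈ s, (N : ℂ) * (suppCpow (r x) θ *
      (unitaryDiag (W x) (fun i => e x i * suppCpow (w x i) θ) *
        (suppPow (τ x) (sandwichExponent α) * Φ x K *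
          suppPow (τ x) (sandwichExponent α))).trace) =
      ((r x ^ θ * (p x * alphaNorm α (suppPow (τ x) (sandwichExponent α) * ξ x *
        suppPow (τ x) (sandwichExponent α))) : ℝ) : ℂ) := by
    intro x hx
    have h1 : (N : ℂ) • Φ x K = (p x : ℂ) • ξ x := by rw [← map_smul, ← hXK, hXξ x hx]
    rw [mul_left_comm, ← smul_eq_mul (N : ℂ), ← trace_smul, ← Matrix.mul_smul, ← Matrix.smul_mul,
      ← Matrix.mul_smul, h1, Matrix.mul_smul, Matrix.smul_mul, Matrix.mul_smul, trace_smul, hW x,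
      suppCpow.ofReal (hr x hx).le, if_neg (hr x hx).ne', smul_eq_mul]
    push_cast
    rfl
  have hfin := mul_le_mul_of_nonneg_left hmain hN0
  rw [mul_one] at hfin
  refine le_trans ?_ hfin
  have hnorm : N = ‖(N : ℂ)‖ := by rw [Complex.norm_real, Real.norm_of_nonneg hN0]
  conv_rhs => rw [hnorm]
  rw [← norm_mul, Finset.mul_sum, Finset.sum_congr rfl hterm, ← Complex.ofReal_sum,
    Complex.norm_real]
  exact le_abs_self _

/-- Jensen's inequality for the logarithm with weights `p`, after which `θ` times the relative
entropy of `p` and `q` is discarded as nonnegative. A subnormalized `q` suffices, which matters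
because outcomes of probability zero are dropped. -/
theorem sum_mul_log_le {ι : Type*} (s : Finset ι) {p q μ : ι → ℝ} {θ M : ℝ} (hθ : 0 ≤ θ)
    (hp : ∀ x ∈ s, 0 < p x) (hq : ∀ x ∈ s, 0 < q x) (hμ : ∀ x ∈ s, 0 < μ x)
    (hp1 : ∑ x ∈ s, p x = 1) (hq1 : ∑ x ∈ s, q x ≤ 1)
    (h : ∑ x ∈ s, (p x / q x) ^ θ * (p x * μ x) ≤ M) :
    ∑ x ∈ s, p x * Real.log (μ x) ≤ Real.log M := by
  have hr : ∀ x ∈ s, 0 < p x / q x := fun x hx => div_pos (hp x hx) (hq x hx)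
  have hpos : ∀ x ∈ s, 0 < (p x / q x) ^ θ * μ x := fun x hx =>
    mul_pos (Real.rpow_pos_of_pos (hr x hx) _) (hμ x hx)
  have h1 := strictConcaveOn_log_Ioi.concaveOn.le_map_sum (t := s) (w := p)
    (p := fun x => (p x / q x) ^ θ * μ x) (fun x hx => (hp x hx).le) hp1 hpos
  simp only [smul_eq_mul] at h1
  have hne : s.Nonempty := by
    rw [Finset.nonempty_iff_ne_empty]
    rintro rfl
    simp at hp1
  have h2 : 0 < ∑ x ∈ s, p x * ((p x / q x) ^ θ * μ x) :=
    Finset.sum_pos (fun x hx => mul_pos (hp x hx) (hpos x hx)) hne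
  have h3 : ∑ x ∈ s, p x * ((p x / q x) ^ θ * μ x) ≤ M := by
    refine le_trans (le_of_eq (Finset.sum_congr rfl fun x _ => ?_)) h
    ring
  have h4 := h1.trans (Real.log_le_log h2 h3)
  -- Gibbs' inequality, from `log t ≥ 1 - 1/t` at `t = p / q`.
  have h5 : 0 ≤ ∑ x ∈ s, p x * Real.log (p x / q x) := by
    have : ∑ x ∈ s, (p x - q x) ≤ ∑ x ∈ s, p x * Real.log (p x / q x) := by
      refine Finset.sum_le_sum fun x hx => ?_
      have := Real.one_sub_inv_le_log_of_pos (hr x hx)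
      have h6 := mul_le_mul_of_nonneg_left this (hp x hx).le
      rwa [mul_sub, mul_one, inv_div, mul_div_cancel₀ _ (hp x hx).ne'] at h6
    rw [Finset.sum_sub_distrib] at this
    linarith
  have h6 : ∑ x ∈ s, p x * Real.log ((p x / q x) ^ θ * μ x) =
      θ * ∑ x ∈ s, p x * Real.log (p x / q x) + ∑ x ∈ s, p x * Real.log (μ x) := by
    rw [Finset.mul_sum, ← Finset.sum_add_distrib]
    refine Finset.sum_congr rfl fun x hx => ?_
    rw [Real.log_mul (Real.rpow_pos_of_pos (hr x hx) _).ne' (hμ x hx).ne',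
      Real.log_rpow (hr x hx)]
    ring
  have := mul_nonneg hθ h5
  linarith

theorem nuAlpha_of_opSupport_le {n : Type*} [Fintype n] [DecidableEq n] {α : ℝ≥0∞}
    {X σ : Matrix n n ℂ} (h : opSupport X ≤ opSupport σ)
    (hpos : 0 < alphaNorm α (suppPow σ (sandwichExponent α) * X * suppPow σ (sandwichExponent α))) :
    nuAlpha α X σ = ((Real.log (alphaNorm α
      (suppPow σ (sandwichExponent α) * X * suppPow σ (sandwichExponent α))) / Real.log 2 : ℝ) :
      EReal) := by
  rw [nuAlpha, muAlpha, if_pos h, ENNReal.log_ofReal, if_neg hpos.not_ge, EReal.coe_div]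

theorem nuAlpha_of_not_opSupport_le {n : Type*} [Fintype n] [DecidableEq n] {α : ℝ≥0∞}
    {X σ : Matrix n n ℂ} (h : ¬ opSupport X ≤ opSupport σ) : nuAlpha α X σ = ⊤ := by
  rw [nuAlpha, muAlpha, if_neg h, ENNReal.log_top]
  exact EReal.top_div_of_pos_ne_top (EReal.coe_pos.2 (Real.log_pos one_lt_two))
    (EReal.coe_ne_top _)

/-- Sandwiching with the opposite exponent recovers `X`, so the sandwich of a nonzero `X` is
nonzero. This keeps `ν_α` away from `-∞`, and real logarithms can be used. -/
theorem alphaNorm_sandwich_pos {n : Type*} [Fintype n] [DecidableEq n] {α : ℝ≥0∞} (hα : 1 ≤ α)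
    {X σ : Matrix n n ℂ} (hσ : σ.PosSemidef) (hX : X.IsHermitian) (hX0 : X ≠ 0)
    (h : opSupport X ≤ opSupport σ) :
    0 < alphaNorm α (suppPow σ (sandwichExponent α) * X * suppPow σ (sandwichExponent α)) := by
  have hZ := isHermitian_suppPow_mul_mul hσ hX (sandwichExponent α)
  refine lt_of_le_of_ne (alphaNorm_nonneg hZ α) fun h0 => hX0 ?_
  have h1 := eq_zero_of_alphaNorm_eq_zero hZ hα h0.symm
  have h2 := sandwich_cancel hσ hX h (-sandwichExponent α)
  rw [neg_neg, h1] at h2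
  simpa using h2.symm

theorem isHermitian_partialTransposeB {A B : Type*} {M : Matrix (A × B) (A × B) ℂ}
    (hM : M.IsHermitian) : (partialTransposeB A B M).IsHermitian := by
  ext i j
  exact congrFun (congrFun hM (i.1, j.2)) (j.1, i.2)

theorem EReal.coe_finsetSum {ι : Type*} (s : Finset ι) (f : ι → ℝ) :
    ((∑ x ∈ s, f x : ℝ) : EReal) = ∑ x ∈ s, (f x : EReal) := by
  classical
  induction s using Finset.induction_on with
  | empty => simp
  | insert a s ha ih => rw [Finset.sum_insert ha, Finset.sum_insert ha, EReal.coe_add, ih]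

/-! ### Monotonicity of the `α`-logarithmic negativity -/

theorem sum_outcomeProb_mul_alphaLogNeg_le {X A B A' B' : Type*} [Fintype X]
    [Fintype A] [Fintype B] [Fintype A'] [Fintype B']
    [DecidableEq A] [DecidableEq B] [DecidableEq A'] [DecidableEq B']
    {N : X → SuperOp (A × B) (A' × B')} (hN : IsCPPTPInstrument N)
    {ρ : Matrix (A × B) (A × B) ℂ} (hρ : IsDensity ρ) {α : ℝ≥0∞} (hα : 1 ≤ α) :
    ∑ x with 0 < outcomeProb (N x) ρ,
        ((outcomeProb (N x) ρ : ℝ) : EReal) * alphaLogNeg α (postState (N x) ρ)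
      ≤ alphaLogNeg α ρ := by
  obtain ⟨hCP, hCPT, hTP⟩ := hN
  refine le_iInf₂ fun σ hσ => ?_
  obtain ⟨hσ0, hσT, hσ1⟩ := hσ
  set Y := partialTransposeB A B ρ with hY
  by_cases hsupp : opSupport Y ≤ opSupport σ
  swap
  · rw [nuAlpha_of_not_opSupport_le hsupp]
    exact le_top
  set s : Finset X := Finset.univ.filter fun x => 0 < outcomeProb (N x) ρ with hs
  set Φ : X → SuperOp (A × B) (A' × B') := fun x =>
    partialTransposeB A' B' ∘ₗ N x ∘ₗ partialTransposeB A B with hΦ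
  set p : X → ℝ := fun x => outcomeProb (N x) ρ with hp
  set q : X → ℝ := fun x => (Φ x σ).trace.re with hq
  have hYh : Y.IsHermitian := isHermitian_partialTransposeB hρ.1.isHermitian
  have hY0 : Y ≠ 0 := fun h0 => by
    have : Y.trace = 1 := hρ.2
    rw [h0, trace_zero] at this
    exact zero_ne_one this
  have hpnn : ∀ x, 0 ≤ p x := fun x =>
    (Complex.le_def.1 ((hCP x).posSemidef_map hρ.1).trace_nonneg).1
  have hΦσ : ∀ x, (Φ x σ).PosSemidef := fun x => (hCPT x).posSemidef_map hσ0
  have hqnn : ∀ x, 0 ≤ q x := fun x => (Complex.le_def.1 (hΦσ x).trace_nonneg).1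
  have hqtr : ∀ x, (Φ x σ).trace = q x := fun x =>
    Complex.ext rfl (by simpa using (Complex.le_def.1 (hΦσ x).trace_nonneg).2.symm)
  have hΦY : ∀ x, Φ x Y = partialTransposeB A' B' (N x ρ) := fun x => rfl
  have hΦtr : ∀ P : Matrix (A × B) (A × B) ℂ, ∑ x, (Φ x P).trace.re = P.trace.re := by
    intro P
    have := congrArg Complex.re (hTP (partialTransposeB A B P))
    rw [LinearMap.sum_apply, trace_sum, Complex.re_sum, trace_partialTransposeB] at this
    exact this
  have htr : ∀ P : Matrix (A × B) (A × B) ℂ, P.PosSemidef →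
      ∑ x ∈ s, (Φ x P).trace.re ≤ P.trace.re := by
    intro P hP
    rw [← hΦtr P]
    exact Finset.sum_le_sum_of_subset_of_nonneg (Finset.subset_univ s) fun x _ _ =>
      (Complex.le_def.1 ((hCPT x).posSemidef_map hP).trace_nonneg).1
  have hpos : ∀ x ∈ s, 0 < p x := fun x hx => (Finset.mem_filter.1 hx).2
  have hp1 : ∑ x ∈ s, p x = 1 := by
    have h1 : ∑ x, p x = 1 := by
      have h2 := hΦtr Y
      have h3 : Y.trace = 1 := hρ.2
      rw [h3, Complex.one_re] at h2
      exact h2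
    rw [← h1]
    refine Finset.sum_subset (Finset.subset_univ s) fun x _ hx => ?_
    have : ¬ 0 < p x := fun h => hx (Finset.mem_filter.2 ⟨Finset.mem_univ x, h⟩)
    exact le_antisymm (not_lt.1 this) (hpnn x)
  have hq1 : ∑ x ∈ s, q x ≤ 1 := by
    have := htr σ hσ0
    rwa [hσ1, Complex.one_re] at this
  have hΦsupp : ∀ x, opSupport (Φ x Y) ≤ opSupport (Φ x σ) := fun x =>
    opSupport_map_le (hCPT x) hσ0 hYh hsupp
  -- If `q x = 0` then `Φ x σ = 0`; support inclusion forces `Φ x Y = 0`, hence `p x = 0`.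
  have hqpos : ∀ x ∈ s, 0 < q x := by
    intro x hx
    refine lt_of_le_of_ne (hqnn x) fun h0 => (hpos x hx).ne' ?_
    have h1 : Φ x σ = 0 := (hΦσ x).trace_eq_zero_iff.1 (by rw [hqtr, ← h0, Complex.ofReal_zero])
    have h2 : Φ x Y = 0 := by
      refine Matrix.ext_of_mulVec_single fun i => ?_
      rw [zero_mulVec]
      exact opSupport_le_iff.1 (hΦsupp x) _ (by rw [h1, zero_mulVec])
    have h3 : p x = (Φ x Y).trace.re := rfl
    rw [h3, h2, trace_zero, Complex.zero_re]
  set τ : X → Matrix (A' × B') (A' × B') ℂ := fun x => ((q x)⁻¹ : ℂ) • Φ x σ with hτ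
  set ξ : X → Matrix (A' × B') (A' × B') ℂ := fun x =>
    partialTransposeB A' B' (postState (N x) ρ) with hξ
  have hqinv : ∀ x, (0 : ℂ) ≤ (q x : ℂ)⁻¹ := fun x => by
    rw [← Complex.ofReal_inv, Complex.zero_le_real]
    exact inv_nonneg.2 (hqnn x)
  -- This holds for all `x`, including `q x = 0`, where the inverse is `0` and `τ x` vanishes.
  have hτ0 : ∀ x, (τ x).PosSemidef := fun x => (hΦσ x).smul (hqinv x)
  have hξ' : ∀ x, ξ x = ((p x)⁻¹ : ℂ) • Φ x Y := fun x => by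
    simp only [hξ, postState, map_smul]
    rfl
  have hξ0 : ∀ x, (ξ x).IsHermitian := fun x => by
    refine isHermitian_partialTransposeB ?_
    refine (((hCP x).posSemidef_map hρ.1).smul ?_).isHermitian
    rw [← Complex.ofReal_inv, Complex.zero_le_real]
    exact inv_nonneg.2 (hpnn x)
  have hστ : ∀ x ∈ s, Φ x σ = (q x : ℂ) • τ x := fun x hx => by
    have : (q x : ℂ) ≠ 0 := by exact_mod_cast (hqpos x hx).ne'
    simp only [hτ, smul_smul, mul_inv_cancel₀ this, one_smul]
  have hYξ : ∀ x ∈ s, Φ x Y = (p x : ℂ) • ξ x := fun x hx => by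
    have : (p x : ℂ) ≠ 0 := by exact_mod_cast (hpos x hx).ne'
    rw [hξ', smul_smul, mul_inv_cancel₀ this, one_smul]
  have hτppt : ∀ x ∈ s, τ x ∈ pptStates A' B' := fun x hx => by
    refine ⟨hτ0 x, ?_, ?_⟩
    -- The two outer partial transposes cancel, so complete positivity of `N x` itself and `T_B(σ) ≥
    -- 0` give the PPT condition.
    · have : partialTransposeB A' B' (τ x) = ((q x)⁻¹ : ℂ) • N x (partialTransposeB A B σ) := by
        simp only [hτ, map_smul]
        rfl
      rw [this]
      exact ((hCP x).posSemidef_map hσT).smul (hqinv x)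
    · have : (q x : ℂ) ≠ 0 := by exact_mod_cast (hqpos x hx).ne'
      simp only [hτ, trace_smul, hqtr, smul_eq_mul, inv_mul_cancel₀ this]
  have hξsupp : ∀ x ∈ s, opSupport (ξ x) ≤ opSupport (τ x) := fun x hx => by
    refine opSupport_le_iff.2 fun v hv => ?_
    rw [hξ', smul_mulVec, opSupport_le_iff.1 (hΦsupp x) v (by
      rw [hστ x hx, smul_mulVec, hv, smul_zero]), smul_zero]
  have hξne : ∀ x ∈ s, ξ x ≠ 0 := fun x hx h0 => by
    have h1 := hYξ x hx
    rw [h0, smul_zero] at h1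
    have h3 : p x = (Φ x Y).trace.re := rfl
    rw [h1, trace_zero, Complex.zero_re] at h3
    exact (hpos x hx).ne' h3
  set μ : X → ℝ := fun x => alphaNorm α
    (suppPow (τ x) (sandwichExponent α) * ξ x * suppPow (τ x) (sandwichExponent α)) with hμ
  have hμpos : ∀ x ∈ s, 0 < μ x := fun x hx =>
    alphaNorm_sandwich_pos hα (hτ0 x) (hξ0 x) (hξne x hx) (hξsupp x hx)
  -- With `r = p / q` the weight condition becomes `∑ p = 1`, and the extra factor `r ^ θ`
  -- contributes only a relative entropy after taking logarithms.
  have hcore := sum_rpow_mul_alphaNorm_le s (Φ := Φ) hCPT htr hσ0 hYh hsupp hτ0 hξ0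
    (p := p) (q := q) (r := fun x => p x / q x) (fun x _ => hqnn x)
    (fun x hx => div_pos (hpos x hx) (hqpos x hx))
    (by
      rw [Finset.sum_congr rfl fun x hx => div_mul_cancel₀ (p x) (hqpos x hx).ne', hp1])
    hστ hYξ hα
  have hlog := sum_mul_log_le s (one_sub_toReal_inv_mem hα).1 hpos hqpos hμpos hp1 hq1 hcore
  rw [nuAlpha_of_opSupport_le hsupp (alphaNorm_sandwich_pos hα hσ0 hYh hY0 hsupp)]
  have hl2 : 0 < Real.log 2 := Real.log_pos one_lt_two
  calc ∑ x ∈ s, (p x : EReal) * alphaLogNeg α (postState (N x) ρ)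
      ≤ ∑ x ∈ s, ((p x * (Real.log (μ x) / Real.log 2) : ℝ) : EReal) := by
        refine Finset.sum_le_sum fun x hx => ?_
        rw [EReal.coe_mul]
        refine mul_le_mul_of_nonneg_left ?_ (EReal.coe_nonneg.2 (hpnn x))
        rw [← nuAlpha_of_opSupport_le (hξsupp x hx) (hμpos x hx)]
        exact iInf₂_le (τ x) (hτppt x hx)
    _ ≤ _ := by
        rw [← EReal.coe_finsetSum, EReal.coe_le_coe_iff]
        rw [le_div_iff₀ hl2, Finset.sum_mul]
        refine le_trans (le_of_eq (Finset.sum_congr rfl fun x _ => ?_)) hlog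
        rw [mul_assoc, div_mul_cancel₀ _ hl2.ne']

theorem IsCPPTPChannel.isCPPTPInstrument {A B A' B' : Type*} [Fintype A] [Fintype B] [Fintype A']
    [Fintype B'] {N : SuperOp (A × B) (A' × B')} (hN : IsCPPTPChannel N) :
    IsCPPTPInstrument (fun _ : Unit => N) :=
  ⟨fun _ => hN.1, fun _ => hN.2.2, by simpa using hN.2.1⟩

theorem alphaLogNeg_map_le {A B A' B' : Type*} [Fintype A] [Fintype B] [Fintype A'] [Fintype B']
    [DecidableEq A] [DecidableEq B] [DecidableEq A'] [DecidableEq B']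
    {N : SuperOp (A × B) (A' × B')} (hN : IsCPPTPChannel N)
    {ρ : Matrix (A × B) (A × B) ℂ} (hρ : IsDensity ρ) {α : ℝ≥0∞} (hα : 1 ≤ α) :
    alphaLogNeg α (N ρ) ≤ alphaLogNeg α ρ := by
  have h := sum_outcomeProb_mul_alphaLogNeg_le hN.isCPPTPInstrument hρ hα
  have hp : outcomeProb N ρ = 1 := by rw [outcomeProb, hN.2.1, hρ.2, Complex.one_re]
  have hpost : postState N ρ = N ρ := by rw [postState, hp]; simp
  simpa [hp, hpost] using h

end

theorem mainTheorem1 {X A B A' B' : Type u} [Fintype X]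
    [Fintype A] [Fintype B] [Fintype A'] [Fintype B']
    [DecidableEq A] [DecidableEq B] [DecidableEq A'] [DecidableEq B'] :
    (∀ N : X → SuperOp (A × B) (A' × B'), IsCPPTPInstrument N →
      ∀ ρ : Matrix (A × B) (A × B) ℂ, IsDensity ρ → ∀ α : ℝ≥0∞, 1 ≤ α →
        ∑ x with 0 < outcomeProb (N x) ρ,
            ((outcomeProb (N x) ρ : ℝ) : EReal) * alphaLogNeg α (postState (N x) ρ)
          ≤ alphaLogNeg α ρ) ∧
    (∀ N : SuperOp (A × B) (A' × B'), IsCPPTPChannel N →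
      ∀ ρ : Matrix (A × B) (A × B) ℂ, IsDensity ρ → ∀ α : ℝ≥0∞, 1 ≤ α →
        alphaLogNeg α (N ρ) ≤ alphaLogNeg α ρ) ∧
    (∀ N : X → SuperOp (A × B) (A' × B'), IsLOCC N → IsCPPTPInstrument N) :=
  ⟨fun _ hN _ hρ _ hα => sum_outcomeProb_mul_alphaLogNeg_le hN hρ hα,
    fun _ hN _ hρ _ hα => alphaLogNeg_map_le hN hρ hα,
    fun _ hN => hN.isCPPTPInstrument⟩
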